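/- **LoP factor.** Let $G$ be a finite simple graph with edge set $E$. For a nonempty $L\subseteq E$ let $\mathcal M_L\subset\{0,1\}^L$ be the set of incidence vectors of the inclusion-maximal matchings contained in $L$ (the maximal schedules of $L$ under primary interference, where two edges interfere if and only if they share a node), and let $\mathrm{Co}(\mathcal M_L)\subset\mathbb R^L$ be its convex hull. The local pooling (LoP) factor $\sigma(G)$ is the supremum of all $s\in[0,1]$ such that for every nonempty $L\subseteq E$ there are no $\mu,\nu\in\mathrm{Co}(\mathcal M_L)$ with $s\,\mu\ge\nu$ coordinatewise (so $\sigma(G)=1$ if $G$ has no edges). **Random geometric graph.** For $r\ge 0$ let $G(n,r)$ be the random graph on $n$ nodes whose positions are independent and uniformly distributed in the unit square $[-1/2,1/2]^2$, where two distinct nodes are adjacent if and only if their Euclidean distance is less than $r$. **Theorem ($\mathbb E[\sigma]$ bounds in $G(n,r_n)$).** Let $c>0$ and let $(r_n)$ be a sequence of nonnegative reals with $r_n^2\sim c/n^{6/5}$, i.e. $r_n^2/(c\,n^{-6/5})\to1$ as $n\to\infty$. Then $\lim_{n\to\infty}\mathbb E[\sigma(G(n,r_n))]$ exists and $$\frac12\;\le\;\lim_{n\to\infty}\mathbb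 E[\sigma(G(n,r_n))]\;\le\;\frac13\left(2+\exp\left(-\frac{(\pi c/4)^5}{6!}\right)\right).$$ -/

import Mathlib

open Filter Topology MeasureTheory Asymptotics

noncomputable section

namespace LocalPooling

/-- `S` is a maximal schedule of the set of links `L`: an inclusion-maximal set of pairwise
non-interfering links of `L`. The vertices of the interference graph `I` are the links. -/
def IsMaximalSchedule {W : Type*} (I : SimpleGraph W) (L S : Set W) : Prop :=
  Maximal (fun T : Set W => T ⊆ L ∧ I.IsIndepSet T) S

/-- The convex hull of the incidence vectors of the maximal schedules of `L`. All these vectors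
vanish outside `L`, so comparing two of them on all links is comparing them on `L`. -/
def scheduleHull {W : Type*} (I : SimpleGraph W) (L : Set W) : Set (W → ℝ) :=
  convexHull ℝ {v | ∃ S, IsMaximalSchedule I L S ∧ v = S.indicator 1}

/-- `L` satisfies `s`-local pooling: no `μ, ν` in the convex hull of the maximal schedules of `L`
satisfy `s * μ ≥ ν` in every coordinate. -/
def SatisfiesLocalPooling {W : Type*} (I : SimpleGraph W) (s : ℝ) (L : Set W) : Prop :=
  ∀ μ ∈ scheduleHull I L, ∀ ν ∈ scheduleHull I L, ¬ ν ≤ s • μ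

/-- The local pooling factor of an interference graph: the supremum of the `s ∈ [0, 1]` for which
every nonempty set of links satisfies `s`-local pooling (so it is `1` if there are no links). -/
def interferenceFactor {W : Type*} (I : SimpleGraph W) : ℝ :=
  sSup {s | s ∈ Set.Icc (0 : ℝ) 1 ∧ ∀ L : Set W, L.Nonempty → SatisfiesLocalPooling I s L}

/-- The LoP factor `σ(G)` under primary interference: the links are the edges of `G`, and two
distinct edges interfere iff they share a node, so the interference graph is the line graph. -/
def sigma {V : Type*} (G : SimpleGraph V) : ℝ :=
  interferenceFactor G.lineGraph

end LocalPooling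

namespace RandomGeometric

/-- The unit square `[-1/2, 1/2]²`. -/
def unitSquare : Set (EuclideanSpace ℝ (Fin 2)) :=
  {x | ∀ i, x i ∈ Set.Icc (-1 / 2 : ℝ) (1 / 2)}

/-- The law of `n` independent uniform points of the unit square (which has area `1`). -/
def positionLaw (n : ℕ) : Measure (Fin n → EuclideanSpace ℝ (Fin 2)) :=
  Measure.pi fun _ => volume.restrict unitSquare

/-- The geometric graph on the positions `x`: two distinct nodes are adjacent iff their Euclidean
distance is less than `r`. -/
def geometricGraph {n : ℕ} (x : Fin n → EuclideanSpace ℝ (Fin 2)) (r : ℝ) :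
    SimpleGraph (Fin n) where
  Adj i j := i ≠ j ∧ dist (x i) (x j) < r
  symm := ⟨fun i j h => ⟨h.1.symm, by rw [dist_comm]; exact h.2⟩⟩
  loopless := ⟨fun _ h => h.1 rfl⟩

/-- The expected LoP factor of the random geometric graph `G(n, r)`. -/
def expectedSigma (n : ℕ) (r : ℝ) : ℝ :=
  ∫ x, LocalPooling.sigma (geometricGraph x r) ∂(positionLaw n)

end RandomGeometric

end

/-! The exponent 6/5 is critical for clusters of six nodes: the expected number of connected k-node
clusters has order n^k r^(2(k-1)), that is n^((6-k)/5). Larger clusters disappear in the limit, and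
graphs on at most five nodes have factor 1 (`satisfiesLocalPooling_of_card_le_five`). The factor
passes to subgraphs and is attained on components (`sigma_lt_of_copy`, `exists_component_sigma_lt`),
so up to a vanishing error it is below t exactly when some six nodes span a graph of factor below t.

The number W of such six-subsets is asymptotically Poisson. Six-subsets that share no node are
independent, and overlapping ones rarely both occur. Hence the generating function F of W nearly
satisfies F' = λF with F(1) = 1, which gives P(W = 0) ≈ exp(-λ)
(`abs_measureReal_count_eq_zero_sub_exp_le`, `abs_measureReal_le_sigma_sub_exp_le`). Rescaling
around one of the six points gives the limit of λ as c^5/6! times the volume of `lowFactorShapes t`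
(`tendsto_positionLaw_six`). So all tails P(σ ≥ t) with t ≤ 1 converge, and integrating them over t
gives the limit of the expectation (`tendsto_expectedSigma`).

The lower bound 1/2 holds for every graph, since two maximal matchings differ in size by a factor of
at most 2. For the upper bound, the hexagon in the complete graph on six nodes gives a factor of at
most 2/3, and six points in a common disc of radius 1/2 form that graph, so the volume is at least
(π/4)^5 for every t > 2/3 (`le_volume_lowFactorShapes`). Then t + (1 - t) P(σ ≥ t) bounds the
expectation, and t decreases to 2/3. -/

namespace LocalPooling

/-! ### Local pooling in an arbitrary interference graph. -/

section InterferenceGraph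

variable {W W' : Type*}

theorem isMaximalSchedule_iff {I : SimpleGraph W} {L S : Set W} :
    IsMaximalSchedule I L S ↔
      S ⊆ L ∧ I.IsIndepSet S ∧ ∀ e ∈ L, e ∉ S → ∃ f ∈ S, I.Adj f e := by
  constructor
  · intro h
    refine ⟨h.prop.1, h.prop.2, fun e he heS => ?_⟩
    by_contra! hno
    have hins : insert e S ⊆ L ∧ I.IsIndepSet (insert e S) := by
      refine ⟨Set.insert_subset he h.prop.1, ?_⟩
      rw [SimpleGraph.isIndepSet_iff]
      exact Set.pairwise_insert.2 ⟨h.prop.2, fun b hb _ =>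
        ⟨fun hadj => hno b hb hadj.symm, hno b hb⟩⟩
    exact heS (h.le_of_ge hins (Set.subset_insert e S) (Set.mem_insert e S))
  · rintro ⟨hL, hI, hmax⟩
    refine ⟨⟨hL, hI⟩, fun T hT hST e he => ?_⟩
    by_contra heS
    obtain ⟨f, hf, hadj⟩ := hmax e (hT.1 he) heS
    exact hT.2 (hST hf) he hadj.ne hadj

theorem IsMaximalSchedule.nonempty {I : SimpleGraph W} {L S : Set W} (hS : IsMaximalSchedule I L S)
    (hL : L.Nonempty) : S.Nonempty := by
  rw [isMaximalSchedule_iff] at hS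
  obtain ⟨e, he⟩ := hL
  by_cases h : e ∈ S
  · exact ⟨e, h⟩
  · obtain ⟨f, hf, -⟩ := hS.2.2 e he h
    exact ⟨f, hf⟩

theorem scheduleHull_nonneg {I : SimpleGraph W} {L : Set W} {v : W → ℝ}
    (hv : v ∈ scheduleHull I L) : 0 ≤ v := by
  refine convexHull_min (t := Set.Ici (0 : W → ℝ)) ?_ (convex_Ici 0) hv
  rintro _ ⟨S, -, rfl⟩
  exact Set.indicator_nonneg fun _ _ => zero_le_one

theorem SatisfiesLocalPooling.mono {I : SimpleGraph W} {L : Set W} {s s' : ℝ} (hs : s ≤ s')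
    (h : SatisfiesLocalPooling I s' L) : SatisfiesLocalPooling I s L := fun μ hμ ν hν hle =>
  h μ hμ ν hν (hle.trans (smul_le_smul_of_nonneg_right hs (scheduleHull_nonneg hμ)))

/-- Local pooling is reflected by monotone linear maps sending schedules to schedules. -/
theorem SatisfiesLocalPooling.of_linearMap {I : SimpleGraph W} {I' : SimpleGraph W'} {L : Set W}
    {L' : Set W'} {s : ℝ} (T : (W' → ℝ) →ₗ[ℝ] (W → ℝ)) (hmono : Monotone T)
    (hT : ∀ S, IsMaximalSchedule I' L' S →
      ∃ S', IsMaximalSchedule I L S' ∧ T (S.indicator 1) = S'.indicator 1)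
    (h : SatisfiesLocalPooling I s L) : SatisfiesLocalPooling I' s L' := by
  have hmem : ∀ v ∈ scheduleHull I' L', T v ∈ scheduleHull I L := by
    intro v hv
    have hv' : T v ∈ T '' scheduleHull I' L' := Set.mem_image_of_mem T hv
    rw [scheduleHull, LinearMap.image_convexHull] at hv'
    refine convexHull_mono ?_ hv'
    rintro _ ⟨_, ⟨S, hS, rfl⟩, rfl⟩
    exact hT S hS
  intro μ hμ ν hν hle
  refine h (T μ) (hmem μ hμ) (T ν) (hmem ν hν) ?_
  rw [← map_smul]
  exact hmono hle

/-- Extension by zero along an induced embedding carries maximal schedules of `L` to maximal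
schedules of its image. -/
theorem SatisfiesLocalPooling.of_image {I : SimpleGraph W} {I' : SimpleGraph W'} (f : I ↪g I')
    {L : Set W} {s : ℝ} (h : SatisfiesLocalPooling I' s (f '' L)) :
    SatisfiesLocalPooling I s L := by
  refine h.of_linearMap (Function.ExtendByZero.linearMap ℝ f) ?_ ?_
  · intro v v' hv e
    by_cases he : ∃ a, f a = e
    · obtain ⟨a, rfl⟩ := he
      simpa [f.injective.extend_apply] using hv a
    · simp [Function.extend_apply' _ _ _ he]
  · intro S hS
    refine ⟨f '' S, ?_, ?_⟩
    · rw [isMaximalSchedule_iff] at hS ⊢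
      obtain ⟨hL, hI, hmax⟩ := hS
      refine ⟨Set.image_mono hL, ?_, ?_⟩
      · rintro _ ⟨a, ha, rfl⟩ _ ⟨b, hb, rfl⟩ hab hadj
        exact hI ha hb (fun h => hab (h ▸ rfl)) (f.map_adj_iff.1 hadj)
      · rintro _ ⟨a, ha, rfl⟩ haS
        obtain ⟨b, hb, hadj⟩ := hmax a ha fun h => haS ⟨a, h, rfl⟩
        exact ⟨f b, ⟨b, hb, rfl⟩, f.map_adj_iff.2 hadj⟩
    · ext e
      by_cases he : ∃ a, f a = e
      · obtain ⟨a, rfl⟩ := he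
        classical
        simp [f.injective.extend_apply, Set.indicator_apply]
      · have : e ∉ f '' S := fun ⟨a, _, ha⟩ => he ⟨a, ha⟩
        simp [Function.extend_apply' _ _ _ he, this]

/-- Restricting coordinates keeps schedules maximal here: by `hsep`, a link that blocks `f a` must
itself lie in the range of `f`. -/
theorem SatisfiesLocalPooling.of_preimage {I : SimpleGraph W} {I' : SimpleGraph W'} (f : I ↪g I')
    {L : Set W'} {s : ℝ} (hsep : ∀ e ∈ L, e ∉ Set.range f → ∀ a, ¬ I'.Adj e (f a))
    (h : SatisfiesLocalPooling I s (f ⁻¹' L)) : SatisfiesLocalPooling I' s L := by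
  refine h.of_linearMap (LinearMap.funLeft ℝ ℝ f) ?_ ?_
  · exact fun v v' hv a => hv (f a)
  · intro S hS
    refine ⟨f ⁻¹' S, ?_, ?_⟩
    · rw [isMaximalSchedule_iff] at hS ⊢
      obtain ⟨hL, hI, hmax⟩ := hS
      refine ⟨Set.preimage_mono hL, ?_, ?_⟩
      · intro a ha b hb hab hadj
        exact hI ha hb (f.injective.ne hab) (f.map_adj_iff.2 hadj)
      · intro a ha haS
        obtain ⟨e, he, hadj⟩ := hmax (f a) ha haS
        by_cases hr : e ∈ Set.range f
        · obtain ⟨b, rfl⟩ := hr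
          exact ⟨b, he, f.map_adj_iff.1 hadj⟩
        · exact absurd hadj (hsep e (hL he) hr a)
    · ext a
      classical
      simp [LinearMap.funLeft_apply, Set.indicator_apply]

/-- A weight for which the maximal schedules differ at most by a factor `K` gives local pooling
for all `s < 1 / K`. -/
theorem satisfiesLocalPooling_of_weight [Fintype W] {I : SimpleGraph W} {L : Set W} {s K : ℝ}
    (w : W → ℝ) (hw : 0 ≤ w) (hs : 0 ≤ s) (hsK : s * K < 1)
    (hpos : ∀ S, IsMaximalSchedule I L S → 0 < ∑ e, w e * S.indicator 1 e)
    (hK : ∀ S S', IsMaximalSchedule I L S → IsMaximalSchedule I L S' →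
      ∑ e, w e * S.indicator 1 e ≤ K * ∑ e, w e * S'.indicator 1 e) :
    SatisfiesLocalPooling I s L := by
  set φ : (W → ℝ) →ₗ[ℝ] ℝ := ∑ e, w e • LinearMap.proj e with hφ
  have hφa : ∀ v, φ v = ∑ e, w e * v e := fun v => by simp [hφ]
  simp only [← hφa] at hpos hK
  -- Each inequality is linear in one argument at a time, so it extends from schedules to their hull
  -- because half-spaces are convex.
  have h1 : ∀ ν ∈ scheduleHull I L, 0 < φ ν := fun ν hν => by
    refine convexHull_min (t := {v | 0 < φ v}) ?_ (convex_halfSpace_gt φ.isLinear 0) hν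
    rintro _ ⟨S, hS, rfl⟩
    exact hpos S hS
  have h2 : ∀ μ ∈ scheduleHull I L, ∀ S', IsMaximalSchedule I L S' →
      φ μ ≤ K * φ (S'.indicator 1) := fun μ hμ S' hS' => by
    refine convexHull_min (t := {v | φ v ≤ K * φ (S'.indicator 1)}) ?_
      (convex_halfSpace_le φ.isLinear _) hμ
    rintro _ ⟨S, hS, rfl⟩
    exact hK S S' hS hS'
  have h3 : ∀ μ ∈ scheduleHull I L, ∀ ν ∈ scheduleHull I L, φ μ ≤ K * φ ν := fun μ hμ ν hν => by
    refine convexHull_min (t := {v | φ μ ≤ (K • φ) v}) ?_ (convex_halfSpace_ge (K • φ).isLinear _)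
      hν
    rintro _ ⟨S', hS', rfl⟩
    exact h2 μ hμ S' hS'
  -- A violation would give φ ν ≤ s φ μ ≤ s K φ ν < φ ν.
  intro μ hμ ν hν hle
  have h4 : φ ν ≤ s * φ μ := by
    rw [hφa, hφa, Finset.mul_sum]
    refine Finset.sum_le_sum fun e _ => ?_
    have := mul_le_mul_of_nonneg_left (hle e) (hw e)
    simp only [Pi.smul_apply, smul_eq_mul] at this
    linarith
  have h5 := mul_le_mul_of_nonneg_left (h3 μ hμ ν hν) hs
  have h6 := mul_lt_mul_of_pos_right hsK (h1 ν hν)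
  linarith

theorem interferenceFactor_le_one (I : SimpleGraph W) : interferenceFactor I ≤ 1 :=
  Real.sSup_le (fun _ h => h.1.2) zero_le_one

theorem le_interferenceFactor {I : SimpleGraph W} {s : ℝ} (hs : s ∈ Set.Icc (0 : ℝ) 1)
    (h : ∀ L : Set W, L.Nonempty → SatisfiesLocalPooling I s L) : s ≤ interferenceFactor I :=
  le_csSup ⟨1, fun _ h => h.1.2⟩ ⟨hs, h⟩

theorem interferenceFactor_nonneg (I : SimpleGraph W) : 0 ≤ interferenceFactor I :=
  Real.sSup_nonneg fun _ h => h.1.1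

theorem interferenceFactor_le_of_not {I : SimpleGraph W} {s : ℝ} (hs : 0 ≤ s) {L : Set W}
    (hL : L.Nonempty) (h : ¬ SatisfiesLocalPooling I s L) : interferenceFactor I ≤ s :=
  Real.sSup_le (fun s' hs' => by
    by_contra! hlt
    exact h ((hs'.2 L hL).mono hlt.le)) hs

/-- This replaces the supremum by a concrete violation, which can be transported between graphs. The
bound `t ≤ 1` matters because the supremum only ranges over `[0, 1]`. -/
theorem interferenceFactor_lt_iff {I : SimpleGraph W} {t : ℝ} (ht : t ≤ 1) :
    interferenceFactor I < t ↔
      ∃ s, 0 ≤ s ∧ s < t ∧ ∃ L : Set W, L.Nonempty ∧ ¬ SatisfiesLocalPooling I s L := by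
  constructor
  · intro h
    obtain ⟨s, hs, hst⟩ := exists_between h
    have hs0 := (interferenceFactor_nonneg I).trans hs.le
    refine ⟨s, hs0, hst, ?_⟩
    by_contra! hno
    exact hs.not_ge (le_interferenceFactor ⟨hs0, hst.le.trans ht⟩ hno)
  · rintro ⟨s, hs, hst, L, hL, hbad⟩
    exact (interferenceFactor_le_of_not hs hL hbad).trans_lt hst

end InterferenceGraph

/-! ### Matchings, small graphs and the hexagon. -/

section PrimaryInterference

variable {V U : Type*}

/-- The line graph of a subgraph, induced or not, is an induced subgraph of the line graph, so
violations persist. -/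
theorem sigma_lt_of_copy {H : SimpleGraph U} {G : SimpleGraph V} (f : SimpleGraph.Copy H G)
    {t : ℝ} (ht : t ≤ 1) (h : sigma H < t) : sigma G < t := by
  rw [sigma, interferenceFactor_lt_iff ht] at h ⊢
  obtain ⟨s, hs, hst, L, hL, hbad⟩ := h
  exact ⟨s, hs, hst, _, hL.image _, fun hG => hbad (hG.of_image f.toLineGraphEmbedding)⟩

/-- The LoP factor of a graph is attained on a connected component. -/
theorem exists_component_sigma_lt {G : SimpleGraph V} {t : ℝ} (ht : t ≤ 1) (h : sigma G < t) :
    ∃ v, ∀ (k : ℕ) (e : Fin k ↪ V), Set.range e = {u | G.Reachable v u} →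
      sigma (G.comap e) < t := by
  rw [sigma, interferenceFactor_lt_iff ht] at h
  obtain ⟨s, hs, hst, L, ⟨l, hl⟩, hbad⟩ := h
  -- Any component containing a link of `L` inherits the violation by restriction, so an arbitrary
  -- link may choose `v`.
  obtain ⟨⟨v, v'⟩, hvv'⟩ := l
  refine ⟨v, fun k e he => ?_⟩
  have hrange : ∀ u, (∃ a, e a = u) ↔ G.Reachable v u := fun u => by
    rw [← Set.mem_range, he]; rfl
  rw [sigma, interferenceFactor_lt_iff ht]
  set f := (SimpleGraph.Embedding.comap e G).toCopy.toLineGraphEmbedding with hf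
  have hfa : ∀ x : (G.comap e).edgeSet, ((f x : G.edgeSet) : Sym2 V) = x.1.map e := fun x => rfl
  have hfr : ∀ x : G.edgeSet, (∃ u ∈ x.1, G.Reachable v u) → x ∈ Set.range f := by
    rintro ⟨⟨a, b⟩, hab⟩ ⟨u, hu, hvu⟩
    have hab' : G.Adj a b := hab
    have h2 : G.Reachable v a ∧ G.Reachable v b := by
      rcases Sym2.mem_iff.1 hu with rfl | rfl
      · exact ⟨hvu, hvu.trans hab'.reachable⟩
      · exact ⟨hvu.trans hab'.symm.reachable, hvu⟩
    obtain ⟨a', rfl⟩ := (hrange a).2 h2.1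
    obtain ⟨b', rfl⟩ := (hrange b).2 h2.2
    exact ⟨⟨s(a', b'), hab'⟩, Subtype.ext rfl⟩
  refine ⟨s, hs, hst, f ⁻¹' L, ?_, fun hH => hbad (hH.of_preimage f ?_)⟩
  · obtain ⟨x, hx⟩ := hfr ⟨_, hvv'⟩ ⟨v, Sym2.mem_mk_left v v', SimpleGraph.Reachable.refl v⟩
    exact ⟨x, by rw [Set.mem_preimage, hx]; exact hl⟩
  · intro x _ hxr a hadj
    refine hxr (hfr x ?_)
    rw [SimpleGraph.lineGraph_adj_iff_exists] at hadj
    obtain ⟨-, u, hux, hua⟩ := hadj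
    refine ⟨u, hux, ?_⟩
    rw [hfa, Sym2.mem_map] at hua
    obtain ⟨a', -, rfl⟩ := hua
    exact (hrange _).1 ⟨a', rfl⟩

theorem IsMaximalSchedule.eq_of_mem {G : SimpleGraph V} {L S : Set G.edgeSet}
    (hS : IsMaximalSchedule G.lineGraph L S) {e f : G.edgeSet} (he : e ∈ S) (hf : f ∈ S) {v : V}
    (hve : v ∈ e.1) (hvf : v ∈ f.1) : e = f := by
  by_contra h
  exact hS.prop.2 he hf h (SimpleGraph.lineGraph_adj_iff_exists.2 ⟨h, v, hve, hvf⟩)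

theorem IsMaximalSchedule.exists_mem {G : SimpleGraph V} {L S : Set G.edgeSet}
    (hS : IsMaximalSchedule G.lineGraph L S) {e : G.edgeSet} (he : e ∈ L) :
    ∃ f ∈ S, ∃ v, v ∈ f.1 ∧ v ∈ e.1 := by
  by_cases h : e ∈ S
  · obtain ⟨⟨a, b⟩, hab⟩ := e
    exact ⟨_, h, a, Sym2.mem_mk_left a b, Sym2.mem_mk_left a b⟩
  · obtain ⟨f, hf, hadj⟩ := (isMaximalSchedule_iff.1 hS).2.2 e he h
    exact ⟨f, hf, (SimpleGraph.lineGraph_adj_iff_exists.1 hadj).2⟩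

open Classical in
/-- The nodes covered by a finite set of edges. -/
noncomputable def coveredNodes {G : SimpleGraph V} (S : Finset G.edgeSet) : Finset V :=
  S.biUnion fun e => e.1.toFinset

open Classical in
theorem card_coveredNodes_le {G : SimpleGraph V} (S : Finset G.edgeSet) :
    (coveredNodes S).card ≤ 2 * S.card := by
  rw [mul_comm]
  refine Finset.card_biUnion_le_card_mul _ _ _ fun e _ => ?_
  exact (Sym2.card_toFinset_of_not_isDiag _ (G.not_isDiag_of_mem_edgeSet e.2)).le

open Classical in
theorem card_coveredNodes {G : SimpleGraph V} [Fintype V] {L S : Set G.edgeSet}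
    (hS : IsMaximalSchedule G.lineGraph L S) :
    (coveredNodes S.toFinset).card = 2 * S.toFinset.card := by
  rw [coveredNodes, Finset.card_biUnion, Finset.sum_const_nat (m := 2), mul_comm]
  · exact fun e _ => Sym2.card_toFinset_of_not_isDiag _ (G.not_isDiag_of_mem_edgeSet e.2)
  · intro e he f hf hef
    refine Finset.disjoint_left.2 ?_
    intro v hve hvf
    exact hef (hS.eq_of_mem (Set.mem_toFinset.1 he) (Set.mem_toFinset.1 hf)
      (Sym2.mem_toFinset.1 hve) (Sym2.mem_toFinset.1 hvf))

open Classical in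
-- Every edge of `S` contains a node covered by `S'`. Distinct edges of the matching `S` use
-- distinct nodes, and `S'` covers at most twice as many nodes as it has edges.
theorem card_maximalSchedule_le {G : SimpleGraph V} [Fintype V] {L S S' : Set G.edgeSet}
    (hS : IsMaximalSchedule G.lineGraph L S) (hS' : IsMaximalSchedule G.lineGraph L S') :
    S.toFinset.card ≤ 2 * S'.toFinset.card := by
  have h : ∀ e : G.edgeSet, ∃ v, e ∈ S → v ∈ e.1 ∧ v ∈ coveredNodes S'.toFinset := by
    intro e
    by_cases he : e ∈ S
    · obtain ⟨f, hf, v, hvf, hve⟩ := hS'.exists_mem (hS.prop.1 he)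
      refine ⟨v, fun _ => ⟨hve, ?_⟩⟩
      rw [coveredNodes, Finset.mem_biUnion]
      exact ⟨f, Set.mem_toFinset.2 hf, Sym2.mem_toFinset.2 hvf⟩
    -- An arbitrary node for edges outside `S`, where nothing is required.
    · exact ⟨e.1.out.1, fun h => absurd h he⟩
  choose v hv using h
  refine (Finset.card_le_card_of_injOn v ?_ ?_).trans (card_coveredNodes_le _)
  · exact fun e he => (hv e (Set.mem_toFinset.1 he)).2
  · intro e he f hf hef
    have he' : e ∈ S := Set.mem_toFinset.1 he
    have hf' : f ∈ S := Set.mem_toFinset.1 hf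
    exact hS.eq_of_mem he' hf' (hv e he').1 (hef ▸ (hv f hf').1)

open Classical in
theorem sum_one_mul_indicator {X : Type*} [Fintype X] (S : Set X) :
    ∑ e, (1 : X → ℝ) e * S.indicator 1 e = (S.toFinset.card : ℝ) := by
  simp [Set.indicator_apply, Set.toFinset_card, Fintype.card_subtype]

theorem satisfiesLocalPooling_of_lt_half [Fintype V] (G : SimpleGraph V) {s : ℝ} (hs : 0 ≤ s)
    (hs' : s < 1 / 2) {L : Set G.edgeSet} (hL : L.Nonempty) :
    SatisfiesLocalPooling G.lineGraph s L := by
  classical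
  refine satisfiesLocalPooling_of_weight (K := 2) 1 zero_le_one hs (by linarith) ?_ ?_
  · intro S hS
    rw [sum_one_mul_indicator]
    obtain ⟨e, he⟩ := hS.nonempty hL
    exact_mod_cast Finset.card_pos.2 ⟨e, Set.mem_toFinset.2 he⟩
  · intro S S' hS hS'
    rw [sum_one_mul_indicator, sum_one_mul_indicator]
    exact_mod_cast card_maximalSchedule_le hS hS'

theorem half_le_sigma [Fintype V] (G : SimpleGraph V) : 1 / 2 ≤ sigma G := by
  refine le_of_forall_lt fun s hs => ?_
  rcases lt_or_ge s 0 with h0 | h0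
  · exact h0.trans_le (interferenceFactor_nonneg _)
  · obtain ⟨s', h1, h2⟩ := exists_between hs
    exact h1.trans_le (le_interferenceFactor ⟨h0.trans h1.le, by linarith⟩
      fun L hL => satisfiesLocalPooling_of_lt_half G (h0.trans h1.le) h2 hL)

theorem sigma_nonneg (G : SimpleGraph V) : 0 ≤ sigma G := interferenceFactor_nonneg _

theorem sigma_le_one (G : SimpleGraph V) : sigma G ≤ 1 := interferenceFactor_le_one _

/-- If every maximal schedule covers the node `a`, the star at `a` is a constant weight. -/
theorem satisfiesLocalPooling_of_covered [Fintype V] {G : SimpleGraph V} {s : ℝ} (hs : 0 ≤ s)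
    (hs' : s < 1) {L : Set G.edgeSet} (a : V)
    (ha : ∀ S, IsMaximalSchedule G.lineGraph L S → ∃ e ∈ S, a ∈ e.1) :
    SatisfiesLocalPooling G.lineGraph s L := by
  classical
  have hsum : ∀ S, IsMaximalSchedule G.lineGraph L S →
      ∑ e : G.edgeSet, (if a ∈ e.1 then (1 : ℝ) else 0) * S.indicator 1 e = 1 := by
    intro S hS
    obtain ⟨e, he, hae⟩ := ha S hS
    rw [Finset.sum_eq_single e]
    · simp [hae, he]
    · intro f _ hfe
      by_cases haf : a ∈ f.1
      · have : f ∉ S := fun hf => hfe (hS.eq_of_mem hf he haf hae)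
        simp [this]
      · simp [haf]
    · simp
  refine satisfiesLocalPooling_of_weight (K := 1) (fun e => if a ∈ e.1 then 1 else 0) ?_ hs
    (by linarith) ?_ ?_
  · intro e
    dsimp only
    split_ifs <;> simp
  · intro S hS
    rw [hsum S hS]
    exact one_pos
  · intro S S' hS hS'
    rw [hsum S hS, hsum S' hS', one_mul]

/-- If one link `ab` is a maximal schedule and `{ac, bd}` is contained in another one, then one of
the two nodes `a`, `b` is covered by all maximal schedules. -/
theorem satisfiesLocalPooling_of_singleton [Fintype V] {G : SimpleGraph V} {s : ℝ} (hs : 0 ≤ s)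
    (hs' : s < 1) {L : Set G.edgeSet} {a b c d : V} (hcd : c ≠ d) (hca : c ≠ a) (hcb : c ≠ b)
    (hda : d ≠ a) (hdb : d ≠ b)
    (hL : ∀ e ∈ L, a ∈ e.1 ∨ b ∈ e.1)
    (hac : ∃ e ∈ L, e.1 = s(a, c)) (hbd : ∃ e ∈ L, e.1 = s(b, d)) :
    SatisfiesLocalPooling G.lineGraph s L := by
  obtain ⟨ac, hacL, hac⟩ := hac
  obtain ⟨bd, hbdL, hbd⟩ := hbd
  by_contra hbad
  have hna : ∃ T, IsMaximalSchedule G.lineGraph L T ∧ ∀ e ∈ T, a ∉ e.1 := by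
    by_contra! h
    exact hbad (satisfiesLocalPooling_of_covered hs hs' a h)
  have hnb : ∃ T, IsMaximalSchedule G.lineGraph L T ∧ ∀ e ∈ T, b ∉ e.1 := by
    by_contra! h
    exact hbad (satisfiesLocalPooling_of_covered hs hs' b h)
  obtain ⟨T, hT, haT⟩ := hna
  obtain ⟨T', hT', hbT'⟩ := hnb
  -- `T'` misses `b`, so it can block a link `bx` only at `x`, and its blocking link then contains
  -- `a`.
  have key : ∀ e ∈ L, ∀ x, e.1 = s(b, x) → ∃ f ∈ T', a ∈ f.1 ∧ x ∈ f.1 := by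
    intro e he x hx
    obtain ⟨f, hf, v, hvf, hve⟩ := hT'.exists_mem he
    rw [hx, Sym2.mem_iff] at hve
    have hbf := hbT' f hf
    rcases hve with rfl | rfl
    · exact absurd hvf hbf
    · exact ⟨f, hf, (hL f (hT'.prop.1 hf)).resolve_right hbf, hvf⟩
  -- `T` misses `a`, so it blocks `ac` at `c` by a link through `b`; thus `bc` belongs to `L`.
  obtain ⟨bc, hbcT, v, hv, hvac⟩ := hT.exists_mem hacL
  rw [hac, Sym2.mem_iff] at hvac
  have hvc : v = c := hvac.resolve_left fun h => haT bc hbcT (h ▸ hv)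
  have hbc : b ∈ bc.1 := (hL bc (hT.prop.1 hbcT)).resolve_left (haT bc hbcT)
  have hbc' : bc.1 = s(b, c) := (Sym2.mem_and_mem_iff hcb.symm).1 ⟨hbc, hvc ▸ hv⟩
  -- Applied to `bc` and `bd`, `key` puts `ac` and `ad` into the matching `T'`. They share `a`, so
  -- they coincide and `c = d`.
  obtain ⟨f, hf, haf, hcf⟩ := key bc (hT.prop.1 hbcT) c hbc'
  obtain ⟨g, hg, hag, hdg⟩ := key bd hbdL d hbd
  have hfg := hT'.eq_of_mem hf hg haf hag
  subst hfg
  have := (Sym2.mem_and_mem_iff hca.symm).1 ⟨haf, hcf⟩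
  rw [this, Sym2.mem_iff] at hdg
  rcases hdg with h | h
  · exact hda h
  · exact hcd h.symm

/-- A matching on five nodes has at most two edges. Either all maximal schedules have equal size and
the constant weight works, or sizes one and two both occur, which is the situation of
`satisfiesLocalPooling_of_singleton`. -/
theorem satisfiesLocalPooling_of_card_le_five [Fintype V] (hV : Fintype.card V ≤ 5)
    (G : SimpleGraph V) {s : ℝ} (hs : 0 ≤ s) (hs' : s < 1) {L : Set G.edgeSet}
    (hL : L.Nonempty) : SatisfiesLocalPooling G.lineGraph s L := by
  classical
  have hone : ∀ S, IsMaximalSchedule G.lineGraph L S → 1 ≤ S.toFinset.card := by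
    intro S hS
    obtain ⟨e, he⟩ := hS.nonempty hL
    exact Finset.card_pos.2 ⟨e, Set.mem_toFinset.2 he⟩
  by_cases hcard : ∀ S S', IsMaximalSchedule G.lineGraph L S → IsMaximalSchedule G.lineGraph L S' →
      S.toFinset.card ≤ S'.toFinset.card
  · refine satisfiesLocalPooling_of_weight (K := 1) 1 zero_le_one hs (by linarith) ?_ ?_
    · intro S hS
      rw [sum_one_mul_indicator]
      exact_mod_cast hone S hS
    · intro S S' hS hS'
      rw [sum_one_mul_indicator, sum_one_mul_indicator, one_mul]
      exact_mod_cast hcard S S' hS hS'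
  push Not at hcard
  obtain ⟨S', S, hS', hS, hlt⟩ := hcard
  have h1 : (coveredNodes S'.toFinset).card ≤ 5 := (Finset.card_le_univ _).trans hV
  rw [card_coveredNodes hS'] at h1
  have h2 := hone S hS
  obtain ⟨e, he⟩ := Finset.card_eq_one.1 (show S.toFinset.card = 1 by omega)
  obtain ⟨f, g, hfg, hfgS⟩ := Finset.card_eq_two.1 (show S'.toFinset.card = 2 by omega)
  have heS : ∀ x, x ∈ S → x = e := fun x hx => by
    have := Set.mem_toFinset.2 hx
    rwa [he, Finset.mem_singleton] at this
  have hf : f ∈ S' := Set.mem_toFinset.1 (hfgS ▸ by simp)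
  have hg : g ∈ S' := Set.mem_toFinset.1 (hfgS ▸ by simp)
  have hmeet : ∀ x ∈ L, ∃ v, v ∈ e.1 ∧ v ∈ x.1 := fun x hx => by
    obtain ⟨y, hy, v, hvy, hvx⟩ := hS.exists_mem hx
    exact ⟨v, heS y hy ▸ hvy, hvx⟩
  -- The disjoint links `f` and `g` both meet the single link `e`, so they meet it at its two
  -- different ends.
  obtain ⟨a, hae, haf⟩ := hmeet f (hS'.prop.1 hf)
  obtain ⟨b, hbe, hbg⟩ := hmeet g (hS'.prop.1 hg)
  have hdisj : ∀ v, v ∈ f.1 → v ∈ g.1 → False := fun v h1 h2 => hfg (hS'.eq_of_mem hf hg h1 h2)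
  have hab : a ≠ b := fun h => hdisj a haf (h ▸ hbg)
  have hes : e.1 = s(a, b) := (Sym2.mem_and_mem_iff hab).1 ⟨hae, hbe⟩
  obtain ⟨c, hc⟩ := Sym2.mem_iff_exists.1 haf
  obtain ⟨d, hd⟩ := Sym2.mem_iff_exists.1 hbg
  have hcf : c ∈ f.1 := hc ▸ Sym2.mem_mk_right a c
  have hdg : d ∈ g.1 := hd ▸ Sym2.mem_mk_right b d
  refine satisfiesLocalPooling_of_singleton (a := a) (b := b) (c := c) (d := d) hs hs' ?_ ?_ ?_ ?_
    ?_ ?_ ⟨f, hS'.prop.1 hf, hc⟩ ⟨g, hS'.prop.1 hg, hd⟩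
  · exact fun h => hdisj c hcf (h ▸ hdg)
  · rintro rfl
    have := G.not_isDiag_of_mem_edgeSet f.2
    rw [hc] at this
    exact this rfl
  · exact fun h => hdisj c hcf (h ▸ hbg)
  · exact fun h => hdisj a haf (h ▸ hdg)
  · rintro rfl
    have := G.not_isDiag_of_mem_edgeSet g.2
    rw [hd] at this
    exact this rfl
  · intro x hx
    obtain ⟨v, hve, hvx⟩ := hmeet x hx
    rw [hes, Sym2.mem_iff] at hve
    rcases hve with rfl | rfl
    · exact Or.inl hvx
    · exact Or.inr hvx

theorem five_lt_card_of_sigma_lt [Fintype V] {G : SimpleGraph V} {t : ℝ} (ht : t ≤ 1)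
    (h : sigma G < t) : 5 < Fintype.card V := by
  by_contra! hV
  rw [sigma, interferenceFactor_lt_iff ht] at h
  obtain ⟨s, hs, hst, L, hL, hbad⟩ := h
  exact hbad (satisfiesLocalPooling_of_card_le_five hV G hs (hst.trans_le ht) hL)

/-- The links of the hexagon inside the complete graph on six nodes. -/
def hexagonEdge (i : Fin 6) : (⊤ : SimpleGraph (Fin 6)).edgeSet :=
  ⟨s(i, i + 1), by revert i; decide⟩

theorem hexagonEdge_adj (i j : Fin 6) :
    (⊤ : SimpleGraph (Fin 6)).lineGraph.Adj (hexagonEdge i) (hexagonEdge j) ↔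
      j = i + 1 ∨ i = j + 1 := by
  rw [SimpleGraph.lineGraph_adj_iff_exists, ne_eq, Subtype.ext_iff]
  simp only [hexagonEdge, Sym2.mem_iff]
  revert i j
  decide

theorem hexagonEdge_injective : Function.Injective hexagonEdge := by
  intro i j h
  rw [Subtype.ext_iff] at h
  simp only [hexagonEdge] at h
  revert i j
  decide

theorem isMaximalSchedule_hexagon (A : Finset (Fin 6))
    (h1 : ∀ i ∈ A, i + 1 ∉ A) (h2 : ∀ i, i ∉ A → i + 1 ∈ A ∨ ∃ j ∈ A, i = j + 1) :
    IsMaximalSchedule ((⊤ : SimpleGraph (Fin 6)).lineGraph.comap hexagonEdge) Set.univ A := by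
  rw [isMaximalSchedule_iff]
  refine ⟨Set.subset_univ _, ?_, ?_⟩
  · intro i hi j hj _ hadj
    rw [SimpleGraph.comap_adj, hexagonEdge_adj] at hadj
    rcases hadj with rfl | rfl
    · exact h1 i hi hj
    · exact h1 j hj hi
  · intro i _ hi
    rcases h2 i hi with h | ⟨j, hj, h⟩
    · exact ⟨i + 1, h, by rw [SimpleGraph.comap_adj, hexagonEdge_adj]; exact Or.inr rfl⟩
    · exact ⟨j, hj, by rw [SimpleGraph.comap_adj, hexagonEdge_adj]; exact Or.inl h⟩

/-- The two perfect matchings of the hexagon average to 1/2 on each edge, while its three pairs of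
opposite edges, which are also maximal, average to 1/3. -/
theorem sigma_completeGraph_six_le : sigma (⊤ : SimpleGraph (Fin 6)) ≤ 2 / 3 := by
  set I := (⊤ : SimpleGraph (Fin 6)).lineGraph.comap hexagonEdge with hI
  have hmem : ∀ A : Finset (Fin 6), IsMaximalSchedule I Set.univ A →
      (A : Set (Fin 6)).indicator 1 ∈ scheduleHull I Set.univ :=
    fun A hA => subset_convexHull ℝ _ ⟨_, hA, rfl⟩
  have hc := convex_convexHull ℝ {v | ∃ S, IsMaximalSchedule I Set.univ S ∧
    v = S.indicator (1 : Fin 6 → ℝ)}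
  have hμ : (fun _ => 1 / 2 : Fin 6 → ℝ) ∈ scheduleHull I Set.univ := by
    have := hc (hmem {0, 2, 4} (isMaximalSchedule_hexagon _ (by decide) (by decide)))
      (hmem {1, 3, 5} (isMaximalSchedule_hexagon _ (by decide) (by decide)))
      (show (0 : ℝ) ≤ 1 / 2 by norm_num) (show (0 : ℝ) ≤ 1 / 2 by norm_num) (by norm_num)
    rw [scheduleHull]
    convert this using 1
    ext i
    fin_cases i <;> simp
  have hν : (fun _ => 1 / 3 : Fin 6 → ℝ) ∈ scheduleHull I Set.univ := by
    have h1 := hc (hmem {0, 3} (isMaximalSchedule_hexagon _ (by decide) (by decide)))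
      (hmem {1, 4} (isMaximalSchedule_hexagon _ (by decide) (by decide)))
      (show (0 : ℝ) ≤ 1 / 2 by norm_num) (show (0 : ℝ) ≤ 1 / 2 by norm_num) (by norm_num)
    -- The weights 2/3 and 1/3 turn the midpoint of two schedules and a third one into the uniform
    -- average of all three.
    have := hc h1 (hmem {2, 5} (isMaximalSchedule_hexagon _ (by decide) (by decide)))
      (show (0 : ℝ) ≤ 2 / 3 by norm_num) (show (0 : ℝ) ≤ 1 / 3 by norm_num) (by norm_num)
    rw [scheduleHull]
    convert this using 1
    ext i
    fin_cases i <;> simp <;> norm_num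
  refine interferenceFactor_le_of_not (by norm_num)
    (Set.image_nonempty.2 (Set.univ_nonempty (α := Fin 6)))
    fun h => (h.of_image (SimpleGraph.Embedding.comap ⟨hexagonEdge, hexagonEdge_injective⟩ _))
      _ hμ _ hν ?_
  intro i
  norm_num

end PrimaryInterference

end LocalPooling

/-! ### Poisson approximation through the generating function. -/

section PoissonApproximation

variable {Ω : Type*} [MeasurableSpace Ω] {P : Measure Ω} [IsProbabilityMeasure P]

theorem integral_comp_nat_eq_sum {W : Ω → ℕ} (hW : Measurable W) {m : ℕ} (hm : ∀ ω, W ω ≤ m)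
    (g : ℕ → ℝ) :
    ∫ ω, g (W ω) ∂P = ∑ k ∈ Finset.range (m + 1), P.real {ω | W ω = k} * g k := by
  have h : ∀ ω, g (W ω) =
      ∑ k ∈ Finset.range (m + 1), {ω | W ω = k}.indicator (fun _ => g k) ω := by
    intro ω
    rw [Finset.sum_eq_single (W ω)]
    · simp
    · intro k _ hk
      simp [hk.symm]
    · intro hk
      exact absurd (Finset.mem_range.2 (Nat.lt_succ_of_le (hm ω))) hk
  have hmeas : ∀ k, MeasurableSet {ω | W ω = k} := fun k => hW (measurableSet_singleton k)
  simp_rw [h]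
  rw [integral_finsetSum]
  · simp [integral_indicator_const, hmeas]
  · exact fun k _ => (integrable_const (g k)).indicator (hmeas k)

theorem abs_setIntegral_sub_le {A B : Set Ω} (hA : MeasurableSet A) {f g : Ω → ℝ}
    (hf : Measurable f) (hg : Measurable g) (hf0 : ∀ ω, f ω ∈ Set.Icc (0 : ℝ) 1)
    (hg0 : ∀ ω, g ω ∈ Set.Icc (0 : ℝ) 1) (h : ∀ ω, ω ∉ A → f ω = g ω) :
    |∫ ω in B, f ω ∂P - ∫ ω in B, g ω ∂P| ≤ P.real (B ∩ A) := by
  have hint : ∀ f : Ω → ℝ, Measurable f → (∀ ω, f ω ∈ Set.Icc (0 : ℝ) 1) →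
      Integrable f (P.restrict B) := fun f hf h0 =>
    Integrable.of_bound hf.aestronglyMeasurable 1 (ae_of_all _ fun ω => by
      rw [Real.norm_eq_abs, abs_of_nonneg (h0 ω).1]; exact (h0 ω).2)
  rw [← integral_sub (hint f hf hf0) (hint g hg hg0), ← Real.norm_eq_abs]
  refine (norm_integral_le_integral_norm _).trans ?_
  have h1 : ∫ ω in B, ‖f ω - g ω‖ ∂P ≤ ∫ ω in B, A.indicator 1 ω ∂P := by
    refine integral_mono ((hint f hf hf0).sub (hint g hg hg0)).norm
      ((integrable_const (1 : ℝ)).indicator hA) fun ω => ?_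
    by_cases hω : ω ∈ A
    · simp only [Set.indicator_of_mem hω, Pi.one_apply, Real.norm_eq_abs]
      have := hf0 ω
      have := hg0 ω
      simp only [Set.mem_Icc] at *
      rw [abs_le]
      constructor <;> linarith
    · simp [h ω hω, hω]
  rw [integral_indicator_one hA, measureReal_restrict_apply hA, Set.inter_comm] at h1
  exact h1

open Classical in
/-- Poisson approximation of the probability that none of the events `B i` occurs: `N i` counts
the events far away from `B i`. -/
theorem abs_measureReal_count_eq_zero_sub_exp_le {ι : Type*} [Fintype ι] {B : ι → Set Ω}
    (hB : ∀ i, MeasurableSet (B i)) {W : Ω → ℕ}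
    (hW : ∀ ω, W ω = (Finset.univ.filter fun i => ω ∈ B i).card) (hWm : Measurable W)
    {N : ι → Ω → ℕ} (hN : ∀ i, Measurable (N i)) {ε : ℝ}
    (hind : ∀ i (u : ℝ), ∫ ω in B i, u ^ N i ω ∂P = P.real (B i) * ∫ ω, u ^ N i ω ∂P)
    (h1 : ∀ i, P.real {ω | W ω ≠ N i ω} ≤ ε)
    (h2 : ∀ i, P.real (B i ∩ {ω | W ω ≠ N i ω + 1}) ≤ P.real (B i) * ε) :
    |P.real {ω | W ω = 0} - Real.exp (-∑ i, P.real (B i))| ≤ 2 * ε * ∑ i, P.real (B i) := by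
  set l := ∑ i, P.real (B i) with hl
  have hl0 : 0 ≤ l := Finset.sum_nonneg fun i _ => measureReal_nonneg
  set m := Fintype.card ι with hm
  have hWle : ∀ ω, W ω ≤ m := fun ω => by rw [hW]; exact Finset.card_le_univ _
  set F : ℝ → ℝ := fun u => ∑ k ∈ Finset.range (m + 1), P.real {ω | W ω = k} * u ^ k with hF
  set D : ℝ → ℝ := fun u =>
    ∑ k ∈ Finset.range (m + 1), P.real {ω | W ω = k} * (k * u ^ (k - 1)) with hD
  have hFint : ∀ u, F u = ∫ ω, u ^ W ω ∂P := fun u =>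
    (integral_comp_nat_eq_sum hWm hWle fun k => u ^ k).symm
  have hDint : ∀ u, D u = ∫ ω, W ω * u ^ (W ω - 1) ∂P := fun u =>
    (integral_comp_nat_eq_sum hWm hWle fun k => k * u ^ (k - 1)).symm
  have hFD : ∀ u, HasDerivAt F (D u) u := fun u =>
    HasDerivAt.fun_sum fun k _ => (hasDerivAt_pow k u).const_mul _
  have hpow : ∀ u ∈ Set.Icc (0 : ℝ) 1, ∀ k : ℕ, u ^ k ∈ Set.Icc (0 : ℝ) 1 := fun u hu k =>
    ⟨pow_nonneg hu.1 k, pow_le_one₀ hu.1 hu.2⟩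
  have hpm : ∀ (u : ℝ) (M : Ω → ℕ), Measurable M → Measurable fun ω => u ^ M ω :=
    fun u M hM => (measurable_from_nat (f := fun k => u ^ k)).comp hM
  -- Writing the factor `W` as the sum of the indicators of the `B i` splits the derivative over the
  -- events.
  have hDsum : ∀ u ∈ Set.Icc (0 : ℝ) 1, D u = ∑ i, ∫ ω in B i, u ^ (W ω - 1) ∂P := by
    intro u hu
    rw [hDint]
    have : ∀ ω, (W ω : ℝ) * u ^ (W ω - 1) =
        ∑ i, (B i).indicator (fun ω => u ^ (W ω - 1)) ω := by
      intro ω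
      rw [← Finset.sum_filter_add_sum_filter_not Finset.univ (fun i => ω ∈ B i),
        Finset.sum_congr rfl (g := fun _ => u ^ (W ω - 1)), Finset.sum_eq_zero (s := Finset.filter
          (fun i => ¬ ω ∈ B i) Finset.univ)]
      · simp [hW]
      · intro i hi
        simp [(Finset.mem_filter.1 hi).2]
      · intro i hi
        simp [(Finset.mem_filter.1 hi).2]
    simp_rw [this]
    rw [integral_finsetSum]
    · simp [integral_indicator, hB]
    · intro i _
      refine Integrable.indicator ?_ (hB i)
      refine Integrable.of_bound (hpm u (fun ω => W ω - 1)
        ((measurable_from_nat (f := fun k => k - 1)).comp hWm)).aestronglyMeasurable 1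
        (ae_of_all _ fun ω => ?_)
      rw [Real.norm_eq_abs, abs_of_nonneg (hpow u hu _).1]
      exact (hpow u hu _).2
  -- Three comparisons: on `B i` the count `W - 1` is mostly `N i`, the integral of `u ^ N i` over
  -- `B i` factors, and without conditioning `N i` is mostly `W`.
  have hbound : ∀ u ∈ Set.Icc (0 : ℝ) 1, |D u - l * F u| ≤ 2 * ε * l := by
    intro u hu
    rw [hDsum u hu, hl, Finset.sum_mul, ← Finset.sum_sub_distrib, Finset.mul_sum]
    refine (Finset.abs_sum_le_sum_abs _ _).trans (Finset.sum_le_sum fun i _ => ?_)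
    have hm1 : Measurable fun ω => W ω - 1 := (measurable_from_nat (f := fun k => k - 1)).comp hWm
    have e1 : |∫ ω in B i, u ^ (W ω - 1) ∂P - ∫ ω in B i, u ^ N i ω ∂P| ≤ P.real (B i) * ε := by
      refine (abs_setIntegral_sub_le (A := {ω | W ω ≠ N i ω + 1}) ?_ (hpm u _ hm1)
        (hpm u _ (hN i)) (fun ω => hpow u hu _) (fun ω => hpow u hu _) fun ω hω => ?_).trans (h2 i)
      · exact (measurableSet_eq_fun hWm
          ((measurable_from_nat (f := fun k => k + 1)).comp (hN i))).compl
      · simp only [ne_eq, Set.mem_ofPred_eq, not_not] at hω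
        simp [hω]
    have e2 : |∫ ω, u ^ N i ω ∂P - F u| ≤ ε := by
      have := abs_setIntegral_sub_le (P := P) (B := Set.univ) (A := {ω | W ω ≠ N i ω})
        (measurableSet_eq_fun hWm (hN i)).compl (hpm u _ (hN i)) (hpm u _ hWm)
        (fun ω => hpow u hu _) (fun ω => hpow u hu _) fun ω hω => by
          simp only [ne_eq, Set.mem_ofPred_eq, not_not] at hω
          simp [hω]
      rw [Measure.restrict_univ, Set.univ_inter, ← hFint] at this
      exact this.trans (h1 i)
    rw [hind] at e1
    have e3 := mul_le_mul_of_nonneg_left e2 (measureReal_nonneg (μ := P) (s := B i))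
    rw [← abs_of_nonneg (measureReal_nonneg (μ := P) (s := B i)), ← abs_mul, mul_sub,
      abs_of_nonneg (measureReal_nonneg (μ := P) (s := B i))] at e3
    calc _ = |(∫ ω in B i, u ^ (W ω - 1) ∂P - P.real (B i) * ∫ ω, u ^ N i ω ∂P) +
          (P.real (B i) * ∫ ω, u ^ N i ω ∂P - P.real (B i) * F u)| := by ring_nf
      _ ≤ _ := abs_add_le _ _
      _ ≤ P.real (B i) * ε + P.real (B i) * ε := add_le_add e1 e3
      _ = 2 * ε * P.real (B i) := by ring
  -- Integrating factor for F' = lF: its derivative is small on `[0, 1]`, and its end values are the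
  -- two quantities compared.
  set ψ : ℝ → ℝ := fun u => F u * Real.exp (-(l * u)) with hψ
  have hψ' : ∀ u, HasDerivAt ψ ((D u - l * F u) * Real.exp (-(l * u))) u := by
    intro u
    have h := (hFD u).mul (((hasDerivAt_id u).const_mul l).neg.exp)
    refine h.congr_deriv ?_
    simp only [id, mul_one, Pi.neg_apply]
    ring
  have hmv := Convex.norm_image_sub_le_of_norm_hasDerivWithin_le (f := ψ) (C := 2 * ε * l)
    (s := Set.Icc (0 : ℝ) 1) (x := 1) (y := 0) (fun u _ => (hψ' u).hasDerivWithinAt) (fun u hu => by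
      rw [Real.norm_eq_abs, abs_mul, abs_of_pos (Real.exp_pos _)]
      have h0 : Real.exp (-(l * u)) ≤ 1 := Real.exp_le_one_iff.2 (by
        have := mul_nonneg hl0 hu.1
        linarith)
      have := mul_le_mul (hbound u hu) h0 (Real.exp_pos _).le ((abs_nonneg _).trans (hbound u hu))
      linarith) (convex_Icc 0 1) (by simp) (by simp)
  have hψ0 : ψ 0 = P.real {ω | W ω = 0} := by
    simp only [hψ, hF, mul_zero, neg_zero, Real.exp_zero, mul_one]
    rw [Finset.sum_eq_single 0]
    · simp
    · intro k _ hk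
      simp [hk]
    · simp
  have hψ1 : ψ 1 = Real.exp (-l) := by
    simp only [hψ, hFint]
    simp
  rw [hψ0, hψ1] at hmv
  simpa using hmv

end PoissonApproximation

/-! ### Independent uniform points and clusters. -/

namespace RandomGeometric

/-- The Euclidean plane. -/
abbrev Plane : Type := EuclideanSpace ℝ (Fin 2)

theorem unitSquare_eq_preimage : unitSquare =
    WithLp.ofLp ⁻¹' Set.univ.pi fun _ => Set.Icc (-1 / 2) (1 / 2) := by
  ext x
  simp only [unitSquare, Set.mem_preimage, Set.mem_pi, Set.mem_univ, forall_const]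
  rfl

theorem measurableSet_unitSquare : MeasurableSet unitSquare := by
  rw [unitSquare_eq_preimage]
  exact (PiLp.volume_preserving_ofLp (Fin 2)).measurable
    (MeasurableSet.univ_pi fun _ => measurableSet_Icc)

theorem volume_unitSquare : volume unitSquare = 1 := by
  rw [unitSquare_eq_preimage,
    (PiLp.volume_preserving_ofLp (Fin 2)).measure_preimage
      (MeasurableSet.univ_pi fun _ => measurableSet_Icc).nullMeasurableSet, volume_pi_pi]
  norm_num

instance isProbabilityMeasure_restrict_unitSquare :
    IsProbabilityMeasure ((volume : Measure Plane).restrict unitSquare) :=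
  ⟨by rw [Measure.restrict_apply_univ, volume_unitSquare]⟩

instance isProbabilityMeasure_positionLaw (n : ℕ) : IsProbabilityMeasure (positionLaw n) := by
  unfold positionLaw
  infer_instance

variable {n : ℕ}

theorem iIndepFun_positionLaw (n : ℕ) :
    ProbabilityTheory.iIndepFun (fun (i : Fin n) (x : Fin n → Plane) => x i) (positionLaw n) :=
  ProbabilityTheory.iIndepFun_pi (X := fun _ => id) fun _ => aemeasurable_id

theorem map_eval_positionLaw (i : Fin n) :
    (positionLaw n).map (fun x => x i) = (volume : Measure Plane).restrict unitSquare :=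
  (measurePreserving_eval _ i).map_eq

/-- Any `k` of the `n` random points are `k` random points. -/
theorem map_comp_positionLaw {k : ℕ} (e : Fin k ↪ Fin n) :
    (positionLaw n).map (fun x => x ∘ e) = positionLaw k := by
  have h := (iIndepFun_positionLaw n).precomp e.injective
  rw [ProbabilityTheory.iIndepFun_iff_map_fun_eq_pi_map
    (fun i => (measurable_pi_apply (e i)).aemeasurable)] at h
  simp only [map_eval_positionLaw] at h
  exact h

/-- There are only finitely many graphs on `Fin n`, and each arises on a set cut out by finitely
many distance comparisons. So nothing about `Q` is needed. -/
theorem measurableSet_geometricGraph (r : ℝ) (Q : SimpleGraph (Fin n) → Prop) :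
    MeasurableSet {x : Fin n → Plane | Q (geometricGraph x r)} := by
  have h : {x : Fin n → Plane | Q (geometricGraph x r)} =
      ⋃ G : {G : SimpleGraph (Fin n) // Q G}, {x | geometricGraph x r = G} := by
    ext x
    simp
  rw [h]
  refine MeasurableSet.iUnion fun G => ?_
  have h2 : {x : Fin n → Plane | geometricGraph x r = G} =
      ⋂ i, ⋂ j, {x | (i ≠ j ∧ dist (x i) (x j) < r) ↔ G.1.Adj i j} := by
    ext x
    simp only [Set.mem_iInter, Set.mem_ofPred_eq]
    exact ⟨fun h i j => by rw [← h]; rfl, fun h => by ext i j; exact h i j⟩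
  rw [h2]
  refine MeasurableSet.iInter fun i => MeasurableSet.iInter fun j => ?_
  have h3 : MeasurableSet {x : Fin n → Plane | dist (x i) (x j) < r} :=
    measurableSet_lt (by fun_prop) measurable_const
  have h4 : MeasurableSet {x : Fin n → Plane | i ≠ j ∧ dist (x i) (x j) < r} :=
    (MeasurableSet.const (i ≠ j)).inter h3
  have h5 : MeasurableSet {x : Fin n → Plane | ¬ (i ≠ j ∧ dist (x i) (x j) < r)} := h4.compl
  by_cases hG : G.1.Adj i j
  · simpa only [hG, iff_true] using h4
  · simpa only [hG, iff_false] using h5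

theorem measurable_geometricGraph (r : ℝ) (f : SimpleGraph (Fin n) → ℝ) :
    Measurable fun x : Fin n → Plane => f (geometricGraph x r) := by
  intro s _
  exact measurableSet_geometricGraph r fun G => f G ∈ s

/-- Functions of disjoint sets of points are independent. -/
theorem indepFun_of_dependsOn {β γ : Type*} [MeasurableSpace β] [MeasurableSpace γ]
    {f : (Fin n → Plane) → β} {g : (Fin n → Plane) → γ} (hf : Measurable f) (hg : Measurable g)
    {S T : Finset (Fin n)} (hST : Disjoint S T) (hfS : DependsOn f S) (hgT : DependsOn g T) :
    ProbabilityTheory.IndepFun f g (positionLaw n) := by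
  classical
  let ext : ∀ S : Finset (Fin n), (S → Plane) → (Fin n → Plane) := fun S a i =>
    if h : i ∈ S then a ⟨i, h⟩ else 0
  have hext : ∀ S, Measurable (ext S) := by
    intro S
    refine measurable_pi_lambda _ fun i => ?_
    by_cases h : i ∈ S
    · simpa [ext, h] using measurable_pi_apply _
    · simp [ext, h]
  have hres : ∀ (S : Finset (Fin n)) (x : Fin n → Plane), ∀ i ∈ S,
      x i = ext S (fun j : S => x j) i := by
    intro S x i hi
    simp [ext, hi]
  have h := ((iIndepFun_positionLaw n).indepFun_finset S T hST
    fun i => measurable_pi_apply i).comp (hf.comp (hext S)) (hg.comp (hext T))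
  convert h using 1
  · ext1 x
    exact hfS (hres S x)
  · ext1 x
    exact hgT (hres T x)

/-- Given an event that does not depend on the point `j`, the point `j` is near another point with
probability at most the area of a disc. -/
theorem measureReal_inter_dist_le {A : Set (Fin n → Plane)} (hA : MeasurableSet A)
    {S : Finset (Fin n)} (hAS : DependsOn (fun x => x ∈ A) (S : Set (Fin n))) {i j : Fin n}
    (hi : i ∈ S) (hj : j ∉ S) {ρ : ℝ} (hρ : 0 ≤ ρ) :
    (positionLaw n).real (A ∩ {x | dist (x i) (x j) ≤ ρ}) ≤
      (positionLaw n).real A * (Real.pi * ρ ^ 2) := by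
  -- The truth value of `A` and the point `x i` form one variable independent of `x j`. Fubini then
  -- bounds the mass of `x j` near each fixed `x i` by a disc area.
  have hf : Measurable fun x : Fin n → Plane => ((x ∈ A : Prop), x i) :=
    (measurable_mem.2 hA).prodMk (measurable_pi_apply i)
  have hind := indepFun_of_dependsOn hf (measurable_pi_apply j)
    (Finset.disjoint_singleton_right.2 hj)
    (fun x y hxy => Prod.ext (hAS hxy) (hxy i hi)) (fun x y hxy => hxy j (by simp))
  rw [ProbabilityTheory.indepFun_iff_map_prod_eq_prod_map_map hf.aemeasurable
    (measurable_pi_apply j).aemeasurable, map_eval_positionLaw] at hind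
  set D : Set ((Prop × Plane) × Plane) := {z | z.1.1 ∧ dist z.1.2 z.2 ≤ ρ} with hD
  have hDm : MeasurableSet D := by
    refine MeasurableSet.inter ?_ (measurableSet_le
      ((measurable_snd.comp measurable_fst).dist measurable_snd) measurable_const)
    exact measurableSet_setOfPred.2 (measurable_fst.comp measurable_fst)
  have hle : positionLaw n (A ∩ {x | dist (x i) (x j) ≤ ρ}) ≤
      positionLaw n A * ENNReal.ofReal (Real.pi * ρ ^ 2) := by
    have h1 : A ∩ {x | dist (x i) (x j) ≤ ρ} =
        (fun x : Fin n → Plane => (((x ∈ A : Prop), x i), x j)) ⁻¹' D := rfl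
    rw [h1, ← Measure.map_apply (hf.prodMk (measurable_pi_apply j)) hDm, hind,
      Measure.prod_apply hDm]
    have hA1 : MeasurableSet {z : Prop × Plane | z.1} :=
      measurableSet_setOfPred.2 measurable_fst
    calc _ ≤ ∫⁻ z, {z : Prop × Plane | z.1}.indicator
          (fun _ => ENNReal.ofReal (Real.pi * ρ ^ 2)) z ∂_ := by
          refine lintegral_mono fun z => ?_
          by_cases hz : z.1
          · rw [Set.indicator_of_mem (show z ∈ {z : Prop × Plane | z.1} from hz)]
            refine (Measure.restrict_apply_le _ _).trans ?_
            refine (measure_mono (t := Metric.closedBall z.2 ρ) fun y hy => ?_).trans ?_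
            · rw [Metric.mem_closedBall, dist_comm]
              exact hy.2
            · rw [EuclideanSpace.volume_closedBall_fin_two, mul_comm,
                ENNReal.ofReal_mul Real.pi_pos.le, ENNReal.ofReal_pow hρ]
          · have : Prod.mk z ⁻¹' D = ∅ := by
              ext y
              simp [hD, hz]
            rw [this]
            simp
      _ = _ := by
          rw [lintegral_indicator_const hA1, Measure.map_apply hf hA1, mul_comm]
          rfl
  rw [measureReal_def, measureReal_def,
    ← ENNReal.toReal_ofReal (mul_nonneg Real.pi_pos.le (sq_nonneg ρ)), ← ENNReal.toReal_mul]
  exact ENNReal.toReal_mono (ENNReal.mul_ne_top (measure_ne_top _ _) ENNReal.ofReal_ne_top) hle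

theorem measurableSet_dist_le (i j : Fin n) (ρ : ℝ) :
    MeasurableSet {x : Fin n → Plane | dist (x i) (x j) ≤ ρ} :=
  measurableSet_le (by fun_prop) measurable_const

theorem measureReal_forall_dist_le (v : Fin n) {T : Finset (Fin n)} (hv : v ∉ T) {ρ : ℝ}
    (hρ : 0 ≤ ρ) : (positionLaw n).real {x | ∀ j ∈ T, dist (x v) (x j) ≤ ρ} ≤
      (Real.pi * ρ ^ 2) ^ T.card := by
  classical
  induction T using Finset.induction_on with
  | empty => simp
  | insert j T hj ih =>
    have hset : {x : Fin n → Plane | ∀ i ∈ insert j T, dist (x v) (x i) ≤ ρ} =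
        {x | ∀ i ∈ T, dist (x v) (x i) ≤ ρ} ∩ {x | dist (x v) (x j) ≤ ρ} := by
      ext x
      simp [and_comm]
    have hvj : v ≠ j := fun h => hv (h ▸ Finset.mem_insert_self j T)
    have hvT : v ∉ T := fun h => hv (Finset.mem_insert_of_mem h)
    rw [hset, Finset.card_insert_of_notMem hj, pow_succ]
    refine (measureReal_inter_dist_le (S := insert v T) ?_ ?_ (Finset.mem_insert_self v T) ?_
      hρ).trans (mul_le_mul_of_nonneg_right (ih hvT) (by positivity))
    · simp only [Set.ofPred_forall]
      exact Finset.measurableSet_biInter T fun i _ => measurableSet_dist_le v i ρ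
    · intro x y hxy
      simp only [Set.mem_ofPred_eq, eq_iff_iff]
      refine forall₂_congr fun i hi => ?_
      rw [hxy v (by simp), hxy i (by simp [hi])]
    · simp [hvj.symm, hj]

/-- The event that some point has `k` other points within distance `ρ`. -/
def clusterEvent (n k : ℕ) (ρ : ℝ) : Set (Fin n → Plane) :=
  {x | ∃ v, ∃ T : Finset (Fin n), T.card = k ∧ v ∉ T ∧ ∀ j ∈ T, dist (x v) (x j) ≤ ρ}

/-- Union bound over the centre and the `k`-subset. For `k = 6` and `ρ` of order `r` it has order
n^7 r^12, which vanishes like n^(-1/5). -/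
theorem measureReal_clusterEvent_le (n k : ℕ) {ρ : ℝ} (hρ : 0 ≤ ρ) :
    (positionLaw n).real (clusterEvent n k ρ) ≤ n * (n ^ k * (Real.pi * ρ ^ 2) ^ k) := by
  have hset : clusterEvent n k ρ ⊆ ⋃ v, ⋃ T ∈ (Finset.powersetCard k Finset.univ).filter (v ∉ ·),
      {x | ∀ j ∈ T, dist (x v) (x j) ≤ ρ} := by
    rintro x ⟨v, T, hT, hv, hx⟩
    simp only [Set.mem_iUnion]
    exact ⟨v, T, by simp [hT, hv], hx⟩
  refine (measureReal_mono hset).trans ((measureReal_iUnion_fintype_le _).trans ?_)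
  have h1 : ∀ v : Fin n, (positionLaw n).real
      (⋃ T ∈ (Finset.powersetCard k Finset.univ).filter (v ∉ ·),
        {x | ∀ j ∈ T, dist (x v) (x j) ≤ ρ}) ≤ n ^ k * (Real.pi * ρ ^ 2) ^ k := by
    intro v
    refine (measureReal_biUnion_finset_le _ _).trans ?_
    refine (Finset.sum_le_card_nsmul _ _ ((Real.pi * ρ ^ 2) ^ k) fun T hT => ?_).trans ?_
    · rw [Finset.mem_filter, Finset.mem_powersetCard] at hT
      rw [← hT.1.2]
      exact measureReal_forall_dist_le v hT.2 hρ
    · rw [nsmul_eq_mul]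
      refine mul_le_mul_of_nonneg_right ?_ (by positivity)
      have h2 := (Finset.card_filter_le (Finset.powersetCard k (Finset.univ : Finset (Fin n)))
        (v ∉ ·)).trans_eq (by
          rw [Finset.card_powersetCard, Finset.card_univ, Fintype.card_fin])
      replace h2 := h2.trans (Nat.choose_le_pow n k)
      exact_mod_cast h2
  refine (Finset.sum_le_card_nsmul _ _ _ fun v _ => h1 v).trans ?_
  simp

/-- A component with more than `k` nodes has `k` nodes near any of its nodes. -/
theorem exists_near_of_lt_card_component (x : Fin n → Plane) {r : ℝ} (v : Fin n) (k : ℕ)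
    (hk : k < {u | (geometricGraph x r).Reachable v u}.ncard) :
    ∃ T : Finset (Fin n), T.card = k ∧ v ∉ T ∧
      ∀ j ∈ T, (geometricGraph x r).Reachable v j ∧ dist (x v) (x j) ≤ k * r := by
  classical
  set G := geometricGraph x r with hG
  induction k with
  | zero => exact ⟨∅, by simp⟩
  | succ k ih =>
    obtain ⟨T, hT, hv, hTd⟩ := ih (by omega)
    obtain ⟨u, hu, huT⟩ : ∃ u, G.Reachable v u ∧ u ∉ insert v T := by
      by_contra! h
      have h2 : {u | G.Reachable v u}.ncard ≤ (insert v T).card := by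
        rw [← Set.ncard_coe_finset]
        exact Set.ncard_le_ncard h (Finset.finite_toSet _)
      rw [Finset.card_insert_of_notMem hv] at h2
      omega
    obtain ⟨p⟩ := hu
    -- A walk to a node outside the current set leaves it along some edge, whose far end is a new
    -- node at most `r` further away.
    obtain ⟨d, -, hd1, hd2⟩ := p.exists_boundary_dart (insert v T : Finset (Fin n)) (by simp) huT
    have hadj : d.fst ≠ d.snd ∧ dist (x d.fst) (x d.snd) < r := d.adj
    have hr : 0 ≤ r := dist_nonneg.trans hadj.2.le
    have hfst : G.Reachable v d.fst ∧ dist (x v) (x d.fst) ≤ k * r := by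
      rcases Finset.mem_insert.1 hd1 with h | h
      · rw [h]
        exact ⟨SimpleGraph.Reachable.refl v, by rw [dist_self]; positivity⟩
      · exact hTd _ h
    have hsnd : d.snd ∉ insert v T := hd2
    rw [Finset.mem_insert, not_or] at hsnd
    refine ⟨insert d.snd T, by rw [Finset.card_insert_of_notMem hsnd.2, hT], ?_, ?_⟩
    · rw [Finset.mem_insert, not_or]
      exact ⟨Ne.symm hsnd.1, hv⟩
    · intro j hj
      rcases Finset.mem_insert.1 hj with rfl | hj
      · refine ⟨hfst.1.trans d.adj.reachable, ?_⟩
        have := dist_triangle (x v) (x d.fst) (x d.snd)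
        push_cast
        linarith [hfst.2, hadj.2]
      · refine ⟨(hTd j hj).1, (hTd j hj).2.trans ?_⟩
        push_cast
        nlinarith

theorem comap_geometricGraph {k : ℕ} (x : Fin n → Plane) (r : ℝ) (e : Fin k ↪ Fin n) :
    (geometricGraph x r).comap e = geometricGraph (x ∘ e) r := by
  ext i j
  simp [geometricGraph]

/-! ### Six-subsets of low LoP factor. -/

open LocalPooling

/-- A geometric graph on six nodes with LoP factor less than `1` is connected. -/
theorem dist_le_of_sigma_lt {y : Fin 6 → Plane} {r t : ℝ} (hr : 0 ≤ r) (ht : t ≤ 1)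
    (h : sigma (geometricGraph y r) < t) (i j : Fin 6) : dist (y i) (y j) ≤ 10 * r := by
  classical
  obtain ⟨v, hv⟩ := exists_component_sigma_lt ht h
  set A := Finset.univ.filter fun u => (geometricGraph y r).Reachable v u with hA
  have hcard := five_lt_card_of_sigma_lt ht
    (hv A.card (A.orderEmbOfFin rfl).toEmbedding (by simp [hA]))
  rw [Fintype.card_fin] at hcard
  obtain ⟨T, hT, hvT, hTd⟩ := exists_near_of_lt_card_component y v 5 (r := r) (by
    rw [← Set.ncard_coe_finset, hA, Finset.coe_filter] at hcard
    simpa using hcard)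
  have huniv : insert v T = Finset.univ := by
    rw [← Finset.card_eq_iff_eq_univ, Finset.card_insert_of_notMem hvT, hT, Fintype.card_fin]
  -- The component of `v` has all six nodes, so each is within `5 * r` of `v`, and two of them are
  -- within `10 * r`.
  have hd : ∀ j, dist (y v) (y j) ≤ 5 * r := by
    intro j
    have hj := Finset.mem_univ j
    rw [← huniv, Finset.mem_insert] at hj
    rcases hj with rfl | hj
    · rw [dist_self]
      positivity
    · exact_mod_cast (hTd j hj).2
  have := dist_triangle_left (y i) (y j) (y v)
  linarith [hd i, hd j]

/-- The index set of the possible locations of components with LoP factor below `1`. -/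
abbrev SixSubset (n : ℕ) : Type := {A : Finset (Fin n) // A.card = 6}

/-- The six nodes of `A` span a geometric graph of LoP factor less than `t`. -/
def lowFactorEvent (r t : ℝ) (A : SixSubset n) : Set (Fin n → Plane) :=
  {x | sigma (geometricGraph (x ∘ A.1.orderEmbOfFin A.2) r) < t}

theorem sigma_lt_of_mem_lowFactorEvent {r t : ℝ} (ht : t ≤ 1) {A : SixSubset n}
    {x : Fin n → Plane} (hx : x ∈ lowFactorEvent r t A) : sigma (geometricGraph x r) < t := by
  refine sigma_lt_of_copy (SimpleGraph.Embedding.comap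
    (A.1.orderEmbOfFin A.2).toEmbedding (geometricGraph x r)).toCopy ht ?_
  rw [comap_geometricGraph]
  exact hx

/-- The component responsible for the low factor has at least six nodes: exactly six give a low
factor event, more give a cluster. -/
theorem mem_lowFactorEvent_or_mem_clusterEvent {r t : ℝ} (ht : t ≤ 1)
    {x : Fin n → Plane} (hx : sigma (geometricGraph x r) < t) :
    (∃ A, x ∈ lowFactorEvent r t A) ∨ x ∈ clusterEvent n 6 (6 * r) := by
  classical
  obtain ⟨v, hv⟩ := exists_component_sigma_lt ht hx
  set A := Finset.univ.filter fun u => (geometricGraph x r).Reachable v u with hA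
  have hrange : ∀ (k : ℕ) (hk : A.card = k), Set.range (A.orderEmbOfFin hk).toEmbedding =
      {u | (geometricGraph x r).Reachable v u} := fun k hk => by
    simp [hA]
  have hcard := five_lt_card_of_sigma_lt ht (hv A.card _ (hrange _ rfl))
  rw [Fintype.card_fin] at hcard
  by_cases h6 : A.card = 6
  · left
    refine ⟨⟨A, h6⟩, ?_⟩
    have := hv 6 _ (hrange 6 h6)
    rwa [comap_geometricGraph] at this
  · right
    have h7 : 6 < A.card := by omega
    obtain ⟨T, hT, hvT, hTd⟩ := exists_near_of_lt_card_component x v 6 (r := r) (by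
      rw [← Set.ncard_coe_finset, hA, Finset.coe_filter] at h7
      simpa using h7)
    exact ⟨v, T, hT, hvT, fun j hj => by exact_mod_cast (hTd j hj).2⟩

theorem measurableSet_lowFactorEvent (r t : ℝ) (A : SixSubset n) :
    MeasurableSet (lowFactorEvent r t A) := by
  have h : Measurable fun x : Fin n → Plane => x ∘ A.1.orderEmbOfFin A.2 := by
    refine measurable_pi_lambda _ fun i => measurable_pi_apply _
  exact h (measurableSet_geometricGraph r fun G => sigma G < t)

theorem dependsOn_lowFactorEvent (r t : ℝ) (A : SixSubset n) :
    DependsOn (fun x => x ∈ lowFactorEvent r t A) (A.1 : Set (Fin n)) := by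
  intro x y hxy
  have h : x ∘ A.1.orderEmbOfFin A.2 = y ∘ A.1.orderEmbOfFin A.2 := by
    ext1 i
    exact hxy _ (Finset.orderEmbOfFin_mem A.1 A.2 i)
  simp only [lowFactorEvent, Set.mem_ofPred_eq, h]

theorem measureReal_lowFactorEvent (r t : ℝ) (A : SixSubset n) :
    (positionLaw n).real (lowFactorEvent r t A) =
      (positionLaw 6).real {y | sigma (geometricGraph y r) < t} := by
  rw [← map_comp_positionLaw (A.1.orderEmbOfFin A.2).toEmbedding, measureReal_def, measureReal_def,
    Measure.map_apply (by fun_prop)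
      (measurableSet_geometricGraph r fun G => sigma G < t)]
  rfl

theorem dist_le_of_mem_lowFactorEvent {r t : ℝ} (hr : 0 ≤ r) (ht : t ≤ 1) {A : SixSubset n}
    {x : Fin n → Plane} (hx : x ∈ lowFactorEvent r t A) {i j : Fin n} (hi : i ∈ A.1)
    (hj : j ∈ A.1) : dist (x i) (x j) ≤ 10 * r := by
  have hrange := Finset.range_orderEmbOfFin A.1 A.2
  obtain ⟨i, rfl⟩ : i ∈ Set.range (A.1.orderEmbOfFin A.2) := hrange ▸ hi
  obtain ⟨j, rfl⟩ : j ∈ Set.range (A.1.orderEmbOfFin A.2) := hrange ▸ hj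
  exact dist_le_of_sigma_lt hr ht hx i j

end RandomGeometric

/-! ### Poisson approximation for low factor six-subsets. -/

namespace RandomGeometric

open LocalPooling

variable {n : ℕ}

open Classical in
theorem measurable_card_filter_mem {Ω ι : Type*} [MeasurableSpace Ω] [Fintype ι] {B : ι → Set Ω}
    (hB : ∀ i, MeasurableSet (B i)) :
    Measurable fun ω => (Finset.univ.filter fun i => ω ∈ B i).card := by
  simp only [Finset.card_filter]
  exact Finset.measurable_sum _ fun i _ =>
    Measurable.ite (hB i) measurable_const measurable_const

open Classical in
/-- The number of low factor events among the six-subsets disjoint from `A`. -/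
noncomputable def farCount (r t : ℝ) (A : SixSubset n) (x : Fin n → Plane) : ℕ :=
  (Finset.univ.filter fun A' : SixSubset n => Disjoint A'.1 A.1 ∧ x ∈ lowFactorEvent r t A').card

theorem measurable_farCount (r t : ℝ) (A : SixSubset n) : Measurable (farCount r t A) := by
  classical
  have h : ∀ A' : SixSubset n,
      MeasurableSet {x | Disjoint A'.1 A.1 ∧ x ∈ lowFactorEvent r t A'} := fun A' =>
    (MeasurableSet.const (Disjoint A'.1 A.1)).inter (measurableSet_lowFactorEvent r t A')
  have h' := measurable_card_filter_mem h
  simp only [Set.mem_ofPred_eq] at h'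
  exact h'

theorem dependsOn_farCount (r t : ℝ) (A : SixSubset n) :
    DependsOn (farCount r t A) (A.1ᶜ : Finset (Fin n)) := by
  classical
  intro x y hxy
  unfold farCount
  congr 1
  refine Finset.filter_congr fun A' _ => and_congr_right fun hd => ?_
  refine iff_of_eq (dependsOn_lowFactorEvent r t A' fun i hi => hxy i ?_)
  simpa using Finset.disjoint_left.1 hd hi

theorem setIntegral_lowFactorEvent_farCount (r t u : ℝ) (A : SixSubset n) :
    ∫ x in lowFactorEvent r t A, u ^ farCount r t A x ∂(positionLaw n) =
      (positionLaw n).real (lowFactorEvent r t A) *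
        ∫ x, u ^ farCount r t A x ∂(positionLaw n) := by
  classical
  have hA := measurableSet_lowFactorEvent r t A
  have hm : Measurable fun x => u ^ farCount r t A x :=
    (measurable_from_nat (f := fun k => u ^ k)).comp (measurable_farCount r t A)
  have hi : Measurable ((lowFactorEvent r t A).indicator (1 : (Fin n → Plane) → ℝ)) :=
    measurable_one.indicator hA
  have hind := indepFun_of_dependsOn hi hm (disjoint_compl_right (a := A.1)) (fun x y hxy => by
      have := dependsOn_lowFactorEvent r t A hxy
      simp only [eq_iff_iff] at this
      simp [Set.indicator_apply, this])
    (fun x y hxy => congrArg (u ^ ·) (dependsOn_farCount r t A hxy))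
  have := hind.integral_fun_mul_eq_mul_integral hi.aestronglyMeasurable hm.aestronglyMeasurable
  rw [integral_indicator_one hA] at this
  rw [← this, ← integral_indicator hA]
  congr 1 with x
  by_cases hx : x ∈ lowFactorEvent r t A <;> simp [hx]

theorem measureReal_dist_le {i j : Fin n} (hij : i ≠ j) {ρ : ℝ} (hρ : 0 ≤ ρ) :
    (positionLaw n).real {x | dist (x i) (x j) ≤ ρ} ≤ Real.pi * ρ ^ 2 := by
  have := measureReal_inter_dist_le (A := Set.univ) MeasurableSet.univ (S := {i}) (i := i) (j := j)
    (fun x y _ => by simp) (Finset.mem_singleton_self i) (by simpa using hij.symm) hρ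
  simpa using this

theorem measureReal_iUnion_pair_le {A : SixSubset n} {D : Fin n → Fin n → Set (Fin n → Plane)}
    {δ : ℝ} (hD : ∀ i ∈ A.1, ∀ j, (positionLaw n).real (D i j) ≤ δ) :
    (positionLaw n).real (⋃ i ∈ A.1, ⋃ j, D i j) ≤ 6 * (n * δ) := by
  refine (measureReal_biUnion_finset_le _ _).trans ?_
  refine (Finset.sum_le_card_nsmul A.1 _ (n * δ) fun i hi => ?_).trans ?_
  · refine (measureReal_iUnion_fintype_le _).trans ?_
    refine (Finset.sum_le_card_nsmul Finset.univ _ δ fun j _ => hD i hi j).trans ?_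
    simp
  · rw [A.2]
    simp

/-- The first error term is the Poisson error, with ε bounding the chance that some node lies near
one of the six nodes of `A`. The second is the chance of a cluster of more than six nodes, the only
way to have a low factor without a low six-subset. -/
theorem abs_measureReal_le_sigma_sub_exp_le (n : ℕ) {r t : ℝ} (hr : 0 ≤ r) (ht : t ≤ 1) :
    |(positionLaw n).real {x | t ≤ sigma (geometricGraph x r)} -
      Real.exp (-(n.choose 6 * (positionLaw 6).real {y | sigma (geometricGraph y r) < t}))| ≤
    2 * (6 * (n * (Real.pi * (10 * r) ^ 2))) *
      (n.choose 6 * (positionLaw 6).real {y | sigma (geometricGraph y r) < t}) +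
    n * (n ^ 6 * (Real.pi * (6 * r) ^ 2) ^ 6) := by
  classical
  set W : (Fin n → Plane) → ℕ := fun x =>
    (Finset.univ.filter fun A : SixSubset n => x ∈ lowFactorEvent r t A).card with hW
  have hρ : 0 ≤ 10 * r := by positivity
  have hnear : ∀ (A A' : SixSubset n) (x : Fin n → Plane), x ∈ lowFactorEvent r t A' →
      ¬ Disjoint A'.1 A.1 → ∃ i ∈ A.1, ∀ j ∈ A'.1, dist (x i) (x j) ≤ 10 * r := by
    intro A A' x hx hd
    obtain ⟨i, hi', hi⟩ := Finset.not_disjoint_iff.1 hd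
    exact ⟨i, hi, fun j hj => dist_le_of_mem_lowFactorEvent hr ht hx hi' hj⟩
  have hκ : 0 ≤ Real.pi * (10 * r) ^ 2 := by positivity
  have h1 : ∀ A : SixSubset n, (positionLaw n).real {x | W x ≠ farCount r t A x} ≤
      6 * (n * (Real.pi * (10 * r) ^ 2)) := by
    intro A
    refine (measureReal_mono ?_ (measure_ne_top _ _)).trans (measureReal_iUnion_pair_le (A := A)
      (D := fun i j => {x | i ≠ j ∧ dist (x i) (x j) ≤ 10 * r}) fun i _ j => ?_)
    · intro x hx
      obtain ⟨A', hA', hd⟩ : ∃ A' : SixSubset n, x ∈ lowFactorEvent r t A' ∧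
          ¬ Disjoint A'.1 A.1 := by
        by_contra! h
        refine hx (congrArg Finset.card (Finset.filter_congr fun A' _ => ?_))
        exact ⟨fun h' => ⟨h A' h', h'⟩, fun h' => h'.2⟩
      obtain ⟨i, hi, hij⟩ := hnear A A' x hA' hd
      obtain ⟨j, hj, hne⟩ := Finset.exists_mem_ne (show 1 < A'.1.card by rw [A'.2]; norm_num) i
      simp only [Set.mem_iUnion]
      exact ⟨i, hi, j, hne.symm, hij j hj⟩
    · by_cases hij : i = j
      · simpa [hij] using hκ
      · simpa [hij] using measureReal_dist_le hij hρ
  have h2 : ∀ A : SixSubset n, (positionLaw n).real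
      (lowFactorEvent r t A ∩ {x | W x ≠ farCount r t A x + 1}) ≤
      (positionLaw n).real (lowFactorEvent r t A) * (6 * (n * (Real.pi * (10 * r) ^ 2))) := by
    intro A
    refine (measureReal_mono ?_ (measure_ne_top _ _)).trans ((measureReal_iUnion_pair_le (A := A)
      (D := fun i j => lowFactorEvent r t A ∩ {x | j ∉ A.1 ∧ dist (x i) (x j) ≤ 10 * r})
      (δ := (positionLaw n).real (lowFactorEvent r t A) * (Real.pi * (10 * r) ^ 2))
      fun i hi j => ?_).trans_eq (by ring))
    · rintro x ⟨hxA, hx⟩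
      -- `A` overlaps itself and is missing from `farCount`; this accounts for the `+ 1`, and any
      -- further discrepancy needs another overlapping subset.
      obtain ⟨A', hne, hA', hd⟩ : ∃ A' : SixSubset n, A' ≠ A ∧ x ∈ lowFactorEvent r t A' ∧
          ¬ Disjoint A'.1 A.1 := by
        by_contra! h
        refine hx ?_
        have hself : ¬ Disjoint A.1 A.1 := by
          rw [disjoint_self, Finset.bot_eq_empty, ← Finset.card_eq_zero, A.2]
          norm_num
        have hins : (Finset.univ.filter fun A' : SixSubset n => x ∈ lowFactorEvent r t A') =
            insert A (Finset.univ.filter fun A' : SixSubset n =>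
              Disjoint A'.1 A.1 ∧ x ∈ lowFactorEvent r t A') := by
          ext A'
          simp only [Finset.mem_filter, Finset.mem_univ, true_and, Finset.mem_insert]
          refine ⟨fun h' => ?_, ?_⟩
          · by_cases hAA : A' = A
            · exact Or.inl hAA
            · exact Or.inr ⟨h A' hAA h', h'⟩
          · rintro (rfl | h')
            · exact hxA
            · exact h'.2
        simp only [hW, farCount]
        rw [hins, Finset.card_insert_of_notMem]
        exact fun h => hself (Finset.mem_filter.1 h).2.1
      obtain ⟨i, hi, hij⟩ := hnear A A' x hA' hd
      -- Having the same size, a different subset has a node outside `A`. Its position is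
      -- independent of the event of `A`, so the two probabilities multiply.
      obtain ⟨j, hj, hjA⟩ : ∃ j ∈ A'.1, j ∉ A.1 := by
        by_contra! h
        exact hne (Subtype.ext (Finset.eq_of_subset_of_card_le h (by rw [A.2, A'.2])))
      simp only [Set.mem_iUnion]
      exact ⟨i, hi, j, hxA, hjA, hij j hj⟩
    · by_cases hj : j ∈ A.1
      · simpa [hj] using mul_nonneg measureReal_nonneg hκ
      · simpa [hj] using measureReal_inter_dist_le (measurableSet_lowFactorEvent r t A)
          (dependsOn_lowFactorEvent r t A) hi hj hρ
  have hP := abs_measureReal_count_eq_zero_sub_exp_le (P := positionLaw n)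
    (measurableSet_lowFactorEvent r t) (W := W) (fun x => rfl)
    (measurable_card_filter_mem (measurableSet_lowFactorEvent r t))
    (measurable_farCount r t) (fun A u => setIntegral_lowFactorEvent_farCount r t u A) h1 h2
  have hsum : ∑ A : SixSubset n, (positionLaw n).real (lowFactorEvent r t A) =
      n.choose 6 * (positionLaw 6).real {y | sigma (geometricGraph y r) < t} := by
    simp only [measureReal_lowFactorEvent, Finset.sum_const, nsmul_eq_mul, Finset.card_univ,
      Fintype.card_finset_len, Fintype.card_fin]
  rw [hsum] at hP
  have hW0 : ∀ x, W x = 0 ↔ ∀ A, x ∉ lowFactorEvent r t A := fun x => by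
    simp [hW, Finset.filter_eq_empty_iff]
  have hsub : {x | t ≤ sigma (geometricGraph x r)} ⊆ {x | W x = 0} := by
    intro x hx
    rw [Set.mem_ofPred_eq, hW0]
    exact fun A hA => (sigma_lt_of_mem_lowFactorEvent ht hA).not_ge hx
  have hsub' : {x | W x = 0} ⊆
      {x | t ≤ sigma (geometricGraph x r)} ∪ clusterEvent n 6 (6 * r) := by
    intro x hx
    rw [Set.mem_ofPred_eq, hW0] at hx
    by_contra h
    rw [Set.mem_union, not_or] at h
    rcases mem_lowFactorEvent_or_mem_clusterEvent ht (not_le.1 h.1) with ⟨A, hA⟩ | h'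
    · exact hx A hA
    · exact h.2 h'
  have m1 := measureReal_mono (μ := positionLaw n) hsub
  have m2 := (measureReal_mono (μ := positionLaw n) hsub').trans (measureReal_union_le _ _)
  have m3 := measureReal_clusterEvent_le n 6 (ρ := 6 * r) (by positivity)
  rw [abs_le] at hP ⊢
  constructor <;> linarith [hP.1, hP.2]

end RandomGeometric

/-! ### Rescaling six points and the volume of low factor shapes. -/

namespace RandomGeometric

open LocalPooling

/-- The positions of five nodes relative to a sixth one, in units of the communication radius, for
which the LoP factor is less than `t`. -/
def lowFactorShapes (t : ℝ) : Set (Fin 5 → Plane) :=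
  {y | sigma (geometricGraph (Fin.cons (0 : Plane) y : Fin 6 → Plane) 1) < t}

theorem measurable_finCons : Measurable
    fun z : Plane × (Fin 5 → Plane) => (Fin.cons z.1 z.2 : Fin 6 → Plane) := by
  refine measurable_pi_lambda _ fun i => ?_
  refine Fin.cases ?_ (fun i => ?_) i
  · simpa using measurable_fst
  · simp only [Fin.cons_succ]
    exact (measurable_pi_apply i).comp measurable_snd

theorem measurableSet_lowFactorShapes (t : ℝ) : MeasurableSet (lowFactorShapes t) := by
  have h : Measurable fun y : Fin 5 → Plane => (Fin.cons (0 : Plane) y : Fin 6 → Plane) :=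
    measurable_finCons.comp (measurable_const.prodMk measurable_id)
  exact h (measurableSet_geometricGraph 1 fun G => sigma G < t)

theorem measurableSet_lowFactorShapes_prod (t ρ : ℝ) :
    MeasurableSet {z : Plane × (Fin 5 → Plane) |
      z.2 ∈ lowFactorShapes t ∧ ∀ i, z.1 + ρ • z.2 i ∈ unitSquare} := by
  have h : MeasurableSet {z : Plane × (Fin 5 → Plane) | ∀ i, z.1 + ρ • z.2 i ∈ unitSquare} := by
    simp only [Set.ofPred_forall]
    refine MeasurableSet.iInter fun i => ?_
    have : Measurable fun z : Plane × (Fin 5 → Plane) => z.1 + ρ • z.2 i := by fun_prop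
    exact this measurableSet_unitSquare
  exact (measurable_snd (measurableSet_lowFactorShapes t)).inter h

/-- A low factor on six nodes forces connectedness, which keeps the other five points in a bounded
disc around the origin. -/
theorem volume_lowFactorShapes_lt_top {t : ℝ} (ht : t ≤ 1) :
    volume (lowFactorShapes t) < ⊤ := by
  have hsub : lowFactorShapes t ⊆ Set.univ.pi fun _ => Metric.closedBall (0 : Plane) 10 := by
    intro y hy i _
    have := dist_le_of_sigma_lt zero_le_one ht hy i.succ 0
    simpa using this
  refine (measure_mono hsub).trans_lt ?_
  rw [volume_pi_pi]
  exact ENNReal.prod_lt_top fun i _ => measure_closedBall_lt_top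

theorem geometricGraph_smul_add {n : ℕ} (x₀ : Plane) (y : Fin n → Plane) {ρ : ℝ} (hρ : 0 < ρ) :
    geometricGraph (fun i => x₀ + ρ • y i) ρ = geometricGraph y 1 := by
  ext i j
  simp only [geometricGraph, dist_add_left, dist_smul₀, Real.norm_eq_abs, abs_of_pos hρ]
  rw [mul_lt_iff_lt_one_right hρ]

/-- Rescaling around the first of the six points. -/
theorem positionLaw_six_eq (t : ℝ) {ρ : ℝ} (hρ : 0 < ρ) :
    positionLaw 6 {x | sigma (geometricGraph x ρ) < t} = ENNReal.ofReal (ρ ^ 10) *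
      (((volume : Measure Plane).restrict unitSquare).prod volume)
        {z : Plane × (Fin 5 → Plane) |
          z.2 ∈ lowFactorShapes t ∧ ∀ i, z.1 + ρ • z.2 i ∈ unitSquare} := by
  set S : Set (Fin 6 → Plane) := {x | sigma (geometricGraph x ρ) < t} with hS
  have hSm : MeasurableSet S := measurableSet_geometricGraph ρ fun G => sigma G < t
  set R : Set (Fin 5 → Plane) := Set.univ.pi fun _ => unitSquare with hR
  set D : Set (Plane × (Fin 5 → Plane)) := {z |
    z.2 ∈ lowFactorShapes t ∧ ∀ i, z.1 + ρ • z.2 i ∈ unitSquare} with hD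
  have hDm : MeasurableSet D := measurableSet_lowFactorShapes_prod t ρ
  have h1 : positionLaw 6 S = (((volume : Measure Plane).restrict unitSquare).prod
      (Measure.pi fun _ : Fin 5 => (volume : Measure Plane).restrict unitSquare))
        ((fun z : Plane × (Fin 5 → Plane) => (Fin.cons z.1 z.2 : Fin 6 → Plane)) ⁻¹' S) := by
    have hmp := (measurePreserving_piFinSuccAbove
      (fun _ : Fin 6 => (volume : Measure Plane).restrict unitSquare) 0).symm
    have hcons : ⇑(MeasurableEquiv.piFinSuccAbove (fun _ : Fin 6 => Plane) 0).symm =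
        fun z => (Fin.cons z.1 z.2 : Fin 6 → Plane) := by
      ext1 z
      exact Fin.insertNth_zero (α := fun _ => Plane) z.1 z.2
    rw [positionLaw, ← hmp.measure_preimage_equiv, hcons]
  rw [h1, Measure.prod_apply (measurable_finCons hSm), Measure.prod_apply hDm,
    ← lintegral_const_mul _ (measurable_measure_prodMk_left hDm)]
  refine lintegral_congr fun x₀ => ?_
  rw [← Measure.restrict_pi_pi, Measure.restrict_apply (measurable_prodMk_left
    (measurable_finCons hSm))]
  set A := Prod.mk x₀ ⁻¹' ((fun z : Plane × (Fin 5 → Plane) =>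
    (Fin.cons z.1 z.2 : Fin 6 → Plane)) ⁻¹' S) ∩ R with hA
  have hpre : Prod.mk x₀ ⁻¹' D =
      (fun y => ρ • y) ⁻¹' ((fun y => (fun _ => x₀ : Fin 5 → Plane) + y) ⁻¹' A) := by
    ext y
    have hcons : (Fin.cons x₀ ((fun _ => x₀ : Fin 5 → Plane) + ρ • y) : Fin 6 → Plane) =
        fun i => x₀ + ρ • (Fin.cons (0 : Plane) y : Fin 6 → Plane) i := by
      ext1 i
      refine Fin.cases ?_ (fun i => ?_) i <;> simp
    simp only [hA, hD, hR, hS, lowFactorShapes, Set.mem_preimage, Set.mem_inter_iff,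
      Set.mem_ofPred_eq, hcons, geometricGraph_smul_add _ _ hρ, Set.mem_pi, Set.mem_univ,
      forall_const, Pi.add_apply, Pi.smul_apply]
  -- Five planar points have ten real coordinates, so the dilation by `ρ` contributes the factor `ρ
  -- ^ 10`.
  rw [hpre, Measure.addHaar_preimage_smul _ hρ.ne', measure_preimage_add, ← mul_assoc,
    ← ENNReal.ofReal_mul (by positivity)]
  have hfin : Module.finrank ℝ (Fin 5 → Plane) = 10 := by
    rw [Module.finrank_pi_fintype]
    simp
  rw [hfin, abs_of_pos (by positivity), mul_inv_cancel₀ (by positivity), ENNReal.ofReal_one,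
    one_mul]
  rfl

theorem convex_unitSquare : Convex ℝ unitSquare := by
  intro x hx y hy a b ha hb hab i
  exact convex_Icc _ _ (hx i) (hy i) ha hb hab

/-- The probability that six random points have LoP factor less than `t`, asymptotically. -/
theorem tendsto_positionLaw_six {t : ℝ} (ht : t ≤ 1) {ρ : ℕ → ℝ} (hρ : ∀ᶠ n in atTop, 0 < ρ n)
    (hρ0 : Tendsto ρ atTop (𝓝 0)) :
    Tendsto (fun n => (positionLaw 6).real {x | sigma (geometricGraph x (ρ n)) < t} / ρ n ^ 10)
      atTop (𝓝 (volume.real (lowFactorShapes t))) := by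
  set μ := ((volume : Measure Plane).restrict unitSquare).prod
    (volume : Measure (Fin 5 → Plane)) with hμ
  set D : ℕ → Set (Plane × (Fin 5 → Plane)) := fun n =>
    {z | z.2 ∈ lowFactorShapes t ∧ ∀ i, z.1 + ρ n • z.2 i ∈ unitSquare} with hD
  have hDm : ∀ n, MeasurableSet (D n) := fun n => measurableSet_lowFactorShapes_prod t (ρ n)
  have hTm : MeasurableSet ((Set.univ : Set Plane) ×ˢ lowFactorShapes t) :=
    MeasurableSet.univ.prod (measurableSet_lowFactorShapes t)
  have hT : μ ((Set.univ : Set Plane) ×ˢ lowFactorShapes t) = volume (lowFactorShapes t) := by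
    rw [hμ, Measure.prod_prod, measure_univ, one_mul]
  -- The boundary of a convex set is null. Almost every base point is interior, so the other five
  -- points eventually stay in the square.
  have hint : ∀ᵐ x ∂((volume : Measure Plane).restrict unitSquare), unitSquare ∈ 𝓝 x := by
    rw [ae_restrict_iff' measurableSet_unitSquare]
    have h0 := convex_unitSquare.addHaar_frontier (volume : Measure Plane)
    filter_upwards [measure_eq_zero_iff_ae_notMem.1 h0] with x hx hxQ
    rw [← mem_interior_iff_mem_nhds]
    by_contra h
    exact hx ⟨subset_closure hxQ, h⟩
  have hlim : Tendsto (fun n => μ (D n)) atTop (𝓝 (volume (lowFactorShapes t))) := by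
    rw [← hT]
    refine tendsto_measure_of_ae_tendsto_indicator atTop hTm hDm hTm ?_ ?_ ?_
    · rw [hT]
      exact (volume_lowFactorShapes_lt_top ht).ne
    · exact Eventually.of_forall fun n z hz => ⟨Set.mem_univ _, hz.1⟩
    · have hae : ∀ᵐ z ∂μ, unitSquare ∈ 𝓝 z.1 := Measure.quasiMeasurePreserving_fst.ae hint
      filter_upwards [hae] with z hz
      have hev : ∀ᶠ n in atTop, ∀ i, z.1 + ρ n • z.2 i ∈ unitSquare := by
        rw [eventually_all]
        intro i
        have h1 : Tendsto (fun n => z.1 + ρ n • z.2 i) atTop (𝓝 (z.1 + (0 : ℝ) • z.2 i)) :=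
          (hρ0.smul_const _).const_add _
        rw [zero_smul, add_zero] at h1
        exact h1.eventually hz
      filter_upwards [hev] with n hn
      simp [hD, hn]
  have hreal := (ENNReal.tendsto_toReal (volume_lowFactorShapes_lt_top ht).ne).comp hlim
  refine hreal.congr' ?_
  filter_upwards [hρ] with n hn
  rw [Function.comp_apply, measureReal_def, positionLaw_six_eq t hn, ENNReal.toReal_mul,
    ENNReal.toReal_ofReal (by positivity), mul_div_cancel_left₀ _ (by positivity)]

/-- Six points in a common disc of radius `1 / 2` form a complete graph. -/
theorem le_volume_lowFactorShapes {t : ℝ} (ht : 2 / 3 < t) (ht' : t ≤ 1) :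
    (Real.pi / 4) ^ 5 ≤ volume.real (lowFactorShapes t) := by
  set b := volume (Metric.ball (0 : Plane) (1 / 2)) with hb
  have hb' : b = ENNReal.ofReal (Real.pi / 4) := by
    rw [hb, EuclideanSpace.volume_ball_fin_two, ← NNReal.coe_real_pi,
      ← ENNReal.ofReal_pow (by norm_num),
      ← ENNReal.ofReal_mul (by norm_num)]
    congr 1
    ring
  have hb0 : b ≠ 0 := by
    rw [hb']
    exact (ENNReal.ofReal_pos.2 (by positivity)).ne'
  have hbt : b ≠ ⊤ := by
    rw [hb']
    exact ENNReal.ofReal_ne_top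
  -- Double counting of disc centres `z` and shapes `y`: fixing `z` first gives exactly `b ^ 5 * b`.
  -- Fixing `y` first gives at most `b` times the volume sought, since `z` lies in the disc around
  -- the origin.
  set D : Set (Plane × (Fin 5 → Plane)) :=
    {z | dist z.1 0 < 1 / 2 ∧ ∀ i, dist (z.2 i) z.1 < 1 / 2} with hD
  have hDm : MeasurableSet D := by
    have h1 : MeasurableSet {z : Plane × (Fin 5 → Plane) | dist z.1 0 < 1 / 2} :=
      measurableSet_lt (by fun_prop) measurable_const
    have h2 : MeasurableSet {z : Plane × (Fin 5 → Plane) | ∀ i, dist (z.2 i) z.1 < 1 / 2} := by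
      simp only [Set.ofPred_forall]
      exact MeasurableSet.iInter fun i => measurableSet_lt (by fun_prop) measurable_const
    exact h1.inter h2
  have h1 : ((volume : Measure Plane).prod (volume : Measure (Fin 5 → Plane))) D = b ^ 5 * b := by
    rw [Measure.prod_apply hDm]
    have : ∀ z : Plane, volume (Prod.mk z ⁻¹' D) =
        (Metric.ball (0 : Plane) (1 / 2)).indicator (fun _ => b ^ 5) z := by
      intro z
      by_cases hz : z ∈ Metric.ball (0 : Plane) (1 / 2)
      · have hpre : Prod.mk z ⁻¹' D = Set.univ.pi fun _ => Metric.ball z (1 / 2) := by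
          ext y
          simp only [hD, Set.mem_preimage, Set.mem_ofPred_eq, Set.mem_pi, Set.mem_univ,
            forall_const, Metric.mem_ball]
          exact and_iff_right hz
        rw [hpre, volume_pi_pi, Set.indicator_of_mem hz]
        simp [hb, Measure.addHaar_ball_center]
      · have hpre : Prod.mk z ⁻¹' D = ∅ := by
          ext y
          simp only [Set.mem_preimage, Set.mem_empty_iff_false, iff_false]
          exact fun h => hz h.1
        rw [hpre, Set.indicator_of_notMem hz, measure_empty]
    simp_rw [this]
    rw [lintegral_indicator_const measurableSet_ball]
  have hdist : ∀ (y : Fin 5 → Plane) (z : Plane), (z, y) ∈ D →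
      ∀ i, dist ((Fin.cons (0 : Plane) y : Fin 6 → Plane) i) z < 1 / 2 := by
    intro y z hz i
    refine Fin.cases ?_ (fun i => ?_) i
    · rw [Fin.cons_zero, dist_comm]
      exact hz.1
    · rw [Fin.cons_succ]
      exact hz.2 i
  have h2 : ((volume : Measure Plane).prod (volume : Measure (Fin 5 → Plane))) D ≤
      b * volume (lowFactorShapes t) := by
    rw [Measure.prod_apply_symm hDm,
      ← lintegral_indicator_const (measurableSet_lowFactorShapes t)]
    refine lintegral_mono fun y => ?_
    by_cases hy : ∃ z, (z, y) ∈ D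
    · obtain ⟨z, hz⟩ := hy
      have htop : geometricGraph (Fin.cons (0 : Plane) y : Fin 6 → Plane) 1 = ⊤ := by
        ext i j
        simp only [SimpleGraph.top_adj]
        refine ⟨fun h => h.1, fun h => ⟨h, ?_⟩⟩
        refine (dist_triangle_right _ _ z).trans_lt ?_
        linarith [hdist y z hz i, hdist y z hz j]
      have hyT : y ∈ lowFactorShapes t := by
        rw [lowFactorShapes, Set.mem_ofPred_eq, htop]
        exact sigma_completeGraph_six_le.trans_lt ht
      rw [Set.indicator_of_mem hyT]
      exact measure_mono fun w hw => hw.1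
    · have hpre : (fun z => (z, y)) ⁻¹' D = ∅ := by
        ext z
        simp only [Set.mem_preimage, Set.mem_empty_iff_false, iff_false]
        exact fun h => hy ⟨z, h⟩
      rw [hpre, measure_empty]
      exact zero_le
  rw [h1, mul_comm] at h2
  have h3 := (ENNReal.mul_le_mul_iff_right hb0 hbt).1 h2
  have h4 := ENNReal.toReal_mono (volume_lowFactorShapes_lt_top ht').ne h3
  rwa [ENNReal.toReal_pow, hb', ENNReal.toReal_ofReal (by positivity)] at h4

end RandomGeometric

/-! ### Limits of the tails and of the expectation. -/

namespace RandomGeometric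

open LocalPooling

theorem measurable_sigma_geometricGraph (n : ℕ) (r : ℝ) :
    Measurable fun x : Fin n → Plane => sigma (geometricGraph x r) :=
  measurable_geometricGraph r sigma

theorem integrable_sigma_geometricGraph (n : ℕ) (r : ℝ) :
    Integrable (fun x : Fin n → Plane => sigma (geometricGraph x r)) (positionLaw n) :=
  Integrable.of_bound (measurable_sigma_geometricGraph n r).aestronglyMeasurable 1
    (ae_of_all _ fun x => by
      rw [Real.norm_eq_abs, abs_of_nonneg (sigma_nonneg _)]
      exact sigma_le_one _)

theorem half_le_expectedSigma (n : ℕ) (r : ℝ) : 1 / 2 ≤ expectedSigma n r := by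
  have h := integral_mono (μ := positionLaw n) (integrable_const (1 / 2 : ℝ))
    (integrable_sigma_geometricGraph n r) fun x => half_le_sigma (geometricGraph x r)
  simpa [expectedSigma] using h

/-- The tail probability of the LoP factor. -/
noncomputable def sigmaTail (n : ℕ) (r t : ℝ) : ℝ :=
  (positionLaw n).real {x | t ≤ sigma (geometricGraph x r)}

theorem antitone_sigmaTail (n : ℕ) (r : ℝ) : Antitone (sigmaTail n r) := fun _ _ hst =>
  measureReal_mono fun _ hx => hst.trans hx

theorem expectedSigma_eq_integral (n : ℕ) (r : ℝ) :
    expectedSigma n r = ∫ t in Set.Ioc (0 : ℝ) 1, sigmaTail n r t := by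
  exact (integrable_sigma_geometricGraph n r).integral_eq_integral_Ioc_meas_le
    (ae_of_all _ fun x => sigma_nonneg _) (ae_of_all _ fun x => sigma_le_one _)

/-- Pointwise the factor is at most `t` where it is below `t`, and at most 1 elsewhere. -/
theorem expectedSigma_le (n : ℕ) (r t : ℝ) :
    expectedSigma n r ≤ t + (1 - t) * sigmaTail n r t := by
  have hm : MeasurableSet {x : Fin n → Plane | t ≤ sigma (geometricGraph x r)} :=
    measurableSet_geometricGraph r fun G => t ≤ sigma G
  have hi : Integrable ({x : Fin n → Plane | t ≤ sigma (geometricGraph x r)}.indicator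
      (1 : (Fin n → Plane) → ℝ)) (positionLaw n) := (integrable_const (1 : ℝ)).indicator hm
  have h := integral_mono (integrable_sigma_geometricGraph n r)
    ((integrable_const t).add (hi.const_mul (1 - t))) fun x => by
      by_cases hx : t ≤ sigma (geometricGraph x r)
      · have hx' : x ∈ {x : Fin n → Plane | t ≤ sigma (geometricGraph x r)} := hx
        simpa [hx'] using sigma_le_one (geometricGraph x r)
      · have hx' : x ∉ {x : Fin n → Plane | t ≤ sigma (geometricGraph x r)} := hx
        simpa [hx'] using (not_le.1 hx).le
  refine h.trans_eq ?_
  simp only [Pi.add_apply]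
  rw [integral_add (integrable_const t) (hi.const_mul (1 - t)), integral_const_mul,
    integral_indicator_one hm]
  simp [sigmaTail]

section Scaling

variable {c : ℝ} {r : ℕ → ℝ}

theorem tendsto_rpow_one_fifth :
    Tendsto (fun n : ℕ => (n : ℝ) ^ (1 / 5 : ℝ)) atTop atTop :=
  (tendsto_rpow_atTop (by norm_num)).comp tendsto_natCast_atTop_atTop

theorem rpow_one_fifth_pow_five (n : ℕ) : ((n : ℝ) ^ (1 / 5 : ℝ)) ^ 5 = n := by
  rw [← Real.rpow_natCast, ← Real.rpow_mul n.cast_nonneg]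
  norm_num

theorem tendsto_sq_mul_pow_six (hc : 0 < c)
    (hrc : (fun n : ℕ => r n ^ 2) ~[atTop] (fun n : ℕ => c / (n : ℝ) ^ (6 / 5 : ℝ))) :
    Tendsto (fun n : ℕ => r n ^ 2 * ((n : ℝ) ^ (1 / 5 : ℝ)) ^ 6) atTop (𝓝 c) := by
  have hpos : ∀ᶠ n : ℕ in atTop, (0 : ℝ) < n := by
    filter_upwards [eventually_gt_atTop 0] with n hn
    exact_mod_cast hn
  rw [isEquivalent_iff_tendsto_one (by
    filter_upwards [hpos] with n hn
    have := Real.rpow_pos_of_pos hn (6 / 5)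
    positivity)] at hrc
  have h := hrc.const_mul c
  rw [mul_one] at h
  refine h.congr' ?_
  filter_upwards [hpos] with n hn
  have h6 : ((n : ℝ) ^ (1 / 5 : ℝ)) ^ 6 = (n : ℝ) ^ (6 / 5 : ℝ) := by
    rw [← Real.rpow_natCast, ← Real.rpow_mul hn.le]
    norm_num
  have := Real.rpow_pos_of_pos hn (6 / 5)
  rw [h6, Pi.div_apply]
  field_simp

theorem tendsto_div_rpow_one_fifth {a : ℕ → ℝ} {b : ℝ} (ha : Tendsto a atTop (𝓝 b)) :
    Tendsto (fun n : ℕ => a n / (n : ℝ) ^ (1 / 5 : ℝ)) atTop (𝓝 0) :=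
  ha.div_atTop tendsto_rpow_one_fifth

theorem eventually_rpow_one_fifth_pos : ∀ᶠ n : ℕ in atTop, 0 < (n : ℝ) ^ (1 / 5 : ℝ) :=
  tendsto_rpow_one_fifth.eventually_gt_atTop 0

/-- The tail probabilities of the LoP factor converge. -/
theorem tendsto_sigmaTail (hc : 0 < c) (hr : ∀ n, 0 ≤ r n)
    (hrc : (fun n : ℕ => r n ^ 2) ~[atTop] (fun n : ℕ => c / (n : ℝ) ^ (6 / 5 : ℝ)))
    {t : ℝ} (ht : t ≤ 1) :
    Tendsto (fun n => sigmaTail n (r n) t) atTop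
      (𝓝 (Real.exp (-(c ^ 5 / (Nat.factorial 6 : ℝ) * volume.real (lowFactorShapes t))))) := by
  -- With `w` the fifth root of `n`, all powers become integral: n = w^5 and r^2 w^6 → c.
  set w : ℕ → ℝ := fun n => (n : ℝ) ^ (1 / 5 : ℝ)
  have hw5 : ∀ n : ℕ, (n : ℝ) = w n ^ 5 := fun n => (rpow_one_fifth_pow_five n).symm
  have hwpos : ∀ᶠ n in atTop, 0 < w n := eventually_rpow_one_fifth_pos
  have ha : Tendsto (fun n => r n ^ 2 * w n ^ 6) atTop (𝓝 c) := tendsto_sq_mul_pow_six hc hrc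
  have hrpos : ∀ᶠ n in atTop, 0 < r n := by
    filter_upwards [ha.eventually (lt_mem_nhds hc)] with n hn
    refine lt_of_le_of_ne (hr n) fun h => ?_
    rw [← h] at hn
    simp at hn
  have hnr : Tendsto (fun n : ℕ => (n : ℝ) * r n ^ 2) atTop (𝓝 0) := by
    refine (tendsto_div_rpow_one_fifth ha).congr' ?_
    filter_upwards [hwpos] with n hn
    change r n ^ 2 * w n ^ 6 / w n = n * r n ^ 2
    rw [hw5 n]
    field_simp
  have hr0 : Tendsto r atTop (𝓝 0) := by
    have h2 : Tendsto (fun n => r n ^ 2) atTop (𝓝 0) := by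
      refine squeeze_zero' (Eventually.of_forall fun n => sq_nonneg _) ?_ hnr
      filter_upwards [eventually_ge_atTop 1] with n hn
      have : (1 : ℝ) ≤ n := by exact_mod_cast hn
      nlinarith [sq_nonneg (r n)]
    have h3 := (Real.continuous_sqrt.tendsto 0).comp h2
    rw [Real.sqrt_zero] at h3
    exact h3.congr fun n => Real.sqrt_sq (hr n)
  -- Here n^7 r^12 = (r^2 w^6)^6 / w.
  have hn7 : Tendsto (fun n : ℕ => (n : ℝ) * (n ^ 6 * (Real.pi * (6 * r n) ^ 2) ^ 6)) atTop
      (𝓝 0) := by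
    have h := (tendsto_div_rpow_one_fifth (ha.pow 6)).const_mul ((36 * Real.pi) ^ 6)
    rw [mul_zero] at h
    refine h.congr' ?_
    filter_upwards [hwpos] with n hn
    change (36 * Real.pi) ^ 6 * ((r n ^ 2 * w n ^ 6) ^ 6 / w n) = _
    rw [hw5 n]
    field_simp
    ring
  have hchoose : Tendsto (fun n : ℕ => (n.choose 6 : ℝ) / (n : ℝ) ^ 6) atTop
      (𝓝 (1 / (Nat.factorial 6 : ℝ))) := by
    have hne : ∀ᶠ n : ℕ in atTop, (n : ℝ) ^ 6 / (Nat.factorial 6 : ℝ) ≠ 0 := by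
      filter_upwards [eventually_gt_atTop 0] with n hn
      have : (0 : ℝ) < n := by exact_mod_cast hn
      positivity
    have h := ((isEquivalent_iff_tendsto_one hne).1 (isEquivalent_choose 6)).mul_const
      (1 / (Nat.factorial 6 : ℝ))
    rw [one_mul] at h
    refine h.congr fun n => ?_
    rw [Pi.div_apply]
    have : (Nat.factorial 6 : ℝ) ≠ 0 := by positivity
    field_simp
  set lam : ℕ → ℝ := fun n => n.choose 6 *
    (positionLaw 6).real {y | sigma (geometricGraph y (r n)) < t} with hlam
  have hlamlim : Tendsto lam atTop
      (𝓝 (c ^ 5 / (Nat.factorial 6 : ℝ) * volume.real (lowFactorShapes t))) := by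
    -- The mean has a finite limit because n^6 r^10 = (r^2 w^6)^5.
    have h := (hchoose.mul (ha.pow 5)).mul (tendsto_positionLaw_six ht hrpos hr0)
    rw [one_div_mul_eq_div] at h
    refine h.congr' ?_
    filter_upwards [hwpos, hrpos] with n hn hrn
    simp only [hlam]
    rw [hw5 n]
    field_simp
  have herr : Tendsto (fun n : ℕ => 2 * (6 * ((n : ℝ) * (Real.pi * (10 * r n) ^ 2))) * lam n +
      n * (n ^ 6 * (Real.pi * (6 * r n) ^ 2) ^ 6)) atTop (𝓝 0) := by
    have h := ((hnr.const_mul (1200 * Real.pi)).mul hlamlim).add hn7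
    rw [mul_zero, zero_mul, add_zero] at h
    refine h.congr fun n => ?_
    ring
  have hdiff : Tendsto (fun n => sigmaTail n (r n) t - Real.exp (-lam n)) atTop (𝓝 0) :=
    squeeze_zero_norm (fun n => abs_measureReal_le_sigma_sub_exp_le n (hr n) ht) herr
  have hexp : Tendsto (fun n => Real.exp (-lam n)) atTop
      (𝓝 (Real.exp (-(c ^ 5 / (Nat.factorial 6 : ℝ) * volume.real (lowFactorShapes t))))) :=
    (Real.continuous_exp.tendsto _).comp hlamlim.neg
  simpa using hdiff.add hexp

/-- Tail probabilities are bounded by 1 and monotone in `t`, hence measurable, so dominated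
convergence applies to the layer-cake integral. -/
theorem tendsto_expectedSigma (hc : 0 < c) (hr : ∀ n, 0 ≤ r n)
    (hrc : (fun n : ℕ => r n ^ 2) ~[atTop] (fun n : ℕ => c / (n : ℝ) ^ (6 / 5 : ℝ))) :
    Tendsto (fun n => expectedSigma n (r n)) atTop (𝓝 (∫ t in Set.Ioc (0 : ℝ) 1,
      Real.exp (-(c ^ 5 / (Nat.factorial 6 : ℝ) * volume.real (lowFactorShapes t))))) := by
  simp_rw [expectedSigma_eq_integral]
  refine tendsto_integral_of_dominated_convergence (fun _ => (1 : ℝ)) (fun n => ?_)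
    (integrable_const 1) (fun n => ae_of_all _ fun t => ?_) ?_
  · exact (antitone_sigmaTail n (r n)).measurable.aestronglyMeasurable
  · rw [Real.norm_eq_abs, sigmaTail, abs_of_nonneg measureReal_nonneg]
    exact measureReal_le_one
  · rw [ae_restrict_iff' measurableSet_Ioc]
    exact ae_of_all _ fun t ht => tendsto_sigmaTail hc hr hrc ht.2

end Scaling

end RandomGeometric

theorem mainTheorem7 (c : ℝ) (hc : 0 < c) (r : ℕ → ℝ) (hr : ∀ n, 0 ≤ r n)
    (hrc : (fun n : ℕ => r n ^ 2) ~[atTop] (fun n : ℕ => c / (n : ℝ) ^ (6 / 5 : ℝ))) :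
    ∃ l : ℝ, Tendsto (fun n : ℕ => RandomGeometric.expectedSigma n (r n)) atTop (𝓝 l) ∧
      1 / 2 ≤ l ∧
      l ≤ 1 / 3 * (2 + Real.exp (-((Real.pi * c / 4) ^ 5 / (Nat.factorial 6 : ℝ)))) := by
  have hlim := RandomGeometric.tendsto_expectedSigma hc hr hrc
  refine ⟨_, hlim, ge_of_tendsto' hlim fun n => RandomGeometric.half_le_expectedSigma n (r n), ?_⟩
  set l := ∫ t in Set.Ioc (0 : ℝ) 1, Real.exp (-(c ^ 5 / (Nat.factorial 6 : ℝ) *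
    volume.real (RandomGeometric.lowFactorShapes t)))
  set q := Real.exp (-((Real.pi * c / 4) ^ 5 / (Nat.factorial 6 : ℝ))) with hq
  have hle : ∀ t ∈ Set.Ioo (2 / 3 : ℝ) 1, l ≤ t + (1 - t) * q := by
    intro t ht
    have h1 := le_of_tendsto_of_tendsto' hlim
      (((RandomGeometric.tendsto_sigmaTail hc hr hrc ht.2.le).const_mul (1 - t)).const_add t)
      fun n => RandomGeometric.expectedSigma_le n (r n) t
    refine h1.trans ?_
    have h2 := RandomGeometric.le_volume_lowFactorShapes ht.1 ht.2.le
    have h3 : Real.exp (-(c ^ 5 / (Nat.factorial 6 : ℝ) *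
        volume.real (RandomGeometric.lowFactorShapes t))) ≤ q := by
      rw [hq, Real.exp_le_exp, neg_le_neg_iff]
      calc (Real.pi * c / 4) ^ 5 / (Nat.factorial 6 : ℝ)
          = c ^ 5 / (Nat.factorial 6 : ℝ) * (Real.pi / 4) ^ 5 := by ring
        _ ≤ _ := mul_le_mul_of_nonneg_left h2 (by positivity)
    have h4 : 0 ≤ 1 - t := by linarith [ht.2]
    linarith [mul_le_mul_of_nonneg_left h3 h4]
  -- The shapes are defined by a strict inequality, so the bound 2/3 for the complete graph is
  -- usable only for `t > 2 / 3`; the endpoint is reached as a limit.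
  have hcont : Tendsto (fun t : ℝ => t + (1 - t) * q) (𝓝[>] (2 / 3))
      (𝓝 (2 / 3 + (1 - 2 / 3) * q)) :=
    ((by fun_prop : Continuous fun t : ℝ => t + (1 - t) * q).tendsto _).mono_left
      nhdsWithin_le_nhds
  have := ge_of_tendsto hcont (by
    filter_upwards [Ioo_mem_nhdsGT (show (2 / 3 : ℝ) < 1 by norm_num)] with t ht
    exact hle t ht)
  linarith
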